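/- **Setting.** Let $\dot A$ be a closed, densely defined, symmetric operator with equal finite deficiency indices in a complex Hilbert space $\mathcal H$, and let $\mathcal H_+\subset\mathcal H\subset\mathcal H_-$ be the associated rigging: $\mathcal H_+=\mathrm{Dom}(\dot A^*)$ with $(f,g)_+=(f,g)+(\dot A^*f,\dot A^*g)$, and $\mathcal H_-$ is its dual with respect to $\mathcal H$. An operator $T$ with $\dot A\subset T\subset\dot A^*$ belongs to the class $\Lambda(\dot A)$ if it is non-symmetric, $\rho(T)\neq\emptyset$ and $\mathrm{Dom}(\dot A)=\mathrm{Dom}(T)\cap\mathrm{Dom}(T^*)$. A bounded operator $\mathbb A:\mathcal H_+\to\mathcal H_-$ is a $(*)$-extension of $T$ if $\mathbb A\supset T$, $\mathbb A^*\supset T^*$, and the quasi-kernel of $\mathrm{Re}\,\mathbb A=\frac12(\mathbb A+\mathbb A^*)$, i.e. the restriction $\hat A$ of $\mathrm{Re}\,\mathbb A$ to $\{f\in\mathcal H_+:\mathrm{Re}\,\mathbb A f\in\mathcal H\}$, is a self-adjoint operator in $\mathcal H$. A (scattering) *L-system with one-dimensional input-output space* $\mathbb C$ is a collection $$\Theta=\begin{pmatrix}\mathbb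 A&K&1\\ \mathcal H_+\subset\mathcal H\subset\mathcal H_-&&\mathbb C\end{pmatrix},$$ where $\mathbb A$ is a $(*)$-extension of an operator $T\in\Lambda(\dot A)$ (the main operator), $K:\mathbb C\to\mathcal H_-$ is bounded, and $\mathrm{Im}\,\mathbb A=\frac1{2i}(\mathbb A-\mathbb A^*)=KK^*$ with $\mathrm{ran}\,K=\mathrm{ran}\,\mathrm{Im}\,\mathbb A$. Its transfer and impedance functions are $$W_\Theta(z)=1-2iK^*(\mathbb A-zI)^{-1}K,\quad z\in\rho(T),\qquad V_\Theta(z)=K^*(\mathrm{Re}\,\mathbb A-zI)^{-1}K,\quad z\in\rho(\hat A).$$ For $Q\in\mathbb R$, the perturbed Donoghue class $\mathfrak M^Q$ consists of the Herglotz–Nevanlinna functions $V$ (analytic on $\mathbb C_+$, with $\mathrm{Im}\,V\ge0$) of the form $$V(z)=Q+\int_{\mathbb R}\Big(\frac1{\lambda-z}-\frac{\lambda}{1+\lambda^2}\Big)\,d\mu(\lambda),\qquad z\in\mathbb C_+,$$ where $\mu$ is an infinite Borel measure on $\mathbb R$ with $\int_{\mathbb R}\frac{d\mu(\lambda)}{1+\lambda^2}=1$.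 For $\alpha\in[0,\pi)$, an L-system $\Theta_\alpha$ with input-output space $\mathbb C$, of the same form but possibly with another state space, is a *unimodular transformation* of $\Theta$ if $W_{\Theta_\alpha}(z)=W_\Theta(z)\cdot(-e^{2i\alpha})$ wherever both transfer functions are defined. It is non-trivial if $\alpha\ne\pi/2$. **Theorem.** Let $\Theta$ be an L-system as above with $V_\Theta\in\mathfrak M^Q$ for some real $Q\neq0$, and let $\Theta_\alpha$ be a non-trivial unimodular transformation of $\Theta$, with $\alpha\in[0,\pi)$, $\alpha\neq\pi/2$. Then $V_{\Theta_\alpha}\in\mathfrak M^{-Q}$ if and only if $\tan\alpha=\dfrac Q2$. -/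

import Mathlib

open MeasureTheory
open scoped ComplexConjugate ENNReal

noncomputable section

namespace LSys

attribute [local instance 2000] InnerProductSpace.toInner

section Rigging

variable {H : Type*} [NormedAddCommGroup H] [InnerProductSpace ℂ H] [CompleteSpace H]

/-- The space `H₊ = Dom(A*)` of the rigging `H₊ ⊂ H ⊂ H₋` associated with a (closed, densely
defined, symmetric) operator `A`.  It carries the graph inner product of `A*`. -/
def HPlus (A : H →ₗ.[ℂ] H) : Type _ := A.adjoint.domain

/-- `(f, g)₊ = (f, g) + (A* f, A* g)` for `f, g ∈ Dom(A*)`. -/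
@[reducible] def graphCore (A : H →ₗ.[ℂ] H) : InnerProductSpace.Core ℂ A.adjoint.domain where
  inner f g := inner ℂ (f : H) (g : H) + inner ℂ (A.adjoint f) (A.adjoint g)
  conj_inner_symm f g := by simp [inner_conj_symm]
  re_inner_nonneg f := by
    simp only [map_add]
    exact add_nonneg inner_self_nonneg inner_self_nonneg
  add_left f g h := by
    simp only [LinearPMap.map_add, Submodule.coe_add, inner_add_left]; ring
  smul_left f g c := by
    simp only [LinearPMap.map_smul, Submodule.coe_smul, inner_smul_left]; ring
  definite f h := by
    have h1 : RCLike.re (inner ℂ (f : H) (f : H)) = (0 : ℝ) := by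
      have h2 := congrArg RCLike.re h
      simp only [map_add, map_zero] at h2
      have h3 := inner_self_nonneg (𝕜 := ℂ) (x := (f : H))
      have h4 := inner_self_nonneg (𝕜 := ℂ) (x := A.adjoint f)
      linarith
    have h5 : (f : H) = 0 := by
      rw [← norm_eq_zero, ← sq_eq_zero_iff, ← inner_self_eq_norm_sq (𝕜 := ℂ)]
      exact h1
    exact Subtype.ext h5

instance (A : H →ₗ.[ℂ] H) : NormedAddCommGroup (HPlus A) :=
  @InnerProductSpace.Core.toNormedAddCommGroup ℂ A.adjoint.domain _ _ _ (graphCore A)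

instance (A : H →ₗ.[ℂ] H) : InnerProductSpace ℂ (HPlus A) :=
  @InnerProductSpace.ofCore ℂ A.adjoint.domain _ _ _ (graphCore A).toCore

/-- The inclusion `H₊ ⊂ H`. -/
def HPlus.incl (A : H →ₗ.[ℂ] H) : HPlus A →ₗ[ℂ] H where
  toFun f := Subtype.val (p := (· ∈ A.adjoint.domain)) f
  map_add' _ _ := rfl
  map_smul' _ _ := rfl

/-- A vector of `Dom(A*)` as an element of `H₊`. -/
def HPlus.mk {A : H →ₗ.[ℂ] H} (f : H) (hf : f ∈ A.adjoint.domain) : HPlus A :=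
  (⟨f, hf⟩ : A.adjoint.domain)

@[simp] theorem HPlus.incl_mk {A : H →ₗ.[ℂ] H} (f : H) (hf : f ∈ A.adjoint.domain) :
    HPlus.incl A (HPlus.mk f hf) = f := rfl

theorem HPlus.incl_mem {A : H →ₗ.[ℂ] H} (f : HPlus A) : HPlus.incl A f ∈ A.adjoint.domain :=
  Subtype.property (p := (· ∈ A.adjoint.domain)) f

theorem HPlus.incl_injective (A : H →ₗ.[ℂ] H) : Function.Injective (HPlus.incl A) :=
  fun _ _ h => Subtype.ext h

/-- The operator `A*` as an everywhere defined operator on `H₊ = Dom(A*)`. -/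
def HPlus.star (A : H →ₗ.[ℂ] H) : HPlus A →ₗ[ℂ] H where
  toFun f := A.adjoint ⟨HPlus.incl A f, HPlus.incl_mem f⟩
  map_add' f g := A.adjoint.map_add ⟨HPlus.incl A f, HPlus.incl_mem f⟩ ⟨_, HPlus.incl_mem g⟩
  map_smul' c f := A.adjoint.map_smul c ⟨HPlus.incl A f, HPlus.incl_mem f⟩

theorem HPlus.inner_def (A : H →ₗ.[ℂ] H) (f g : HPlus A) :
    inner ℂ f g = inner ℂ (HPlus.incl A f) (HPlus.incl A g)
      + inner ℂ (HPlus.star A f) (HPlus.star A g) := rfl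

theorem HPlus.norm_incl_le (A : H →ₗ.[ℂ] H) (f : HPlus A) : ‖HPlus.incl A f‖ ≤ ‖f‖ := by
  have h : ‖f‖ ^ 2 = ‖HPlus.incl A f‖ ^ 2 + ‖HPlus.star A f‖ ^ 2 := by
    have h0 := congrArg RCLike.re (HPlus.inner_def A f f)
    rw [map_add] at h0
    simpa only [inner_self_eq_norm_sq] using h0
  exact le_of_sq_le_sq (by nlinarith [sq_nonneg ‖HPlus.star A f‖]) (norm_nonneg f)

/-- The space `H₋` of the rigging: the bounded antilinear functionals on `H₊`.  The value `φ f` is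
the pairing `(φ, f)`, linear in `φ ∈ H₋` and antilinear in `f ∈ H₊`. -/
abbrev HMinus (A : H →ₗ.[ℂ] H) : Type _ := HPlus A →L⋆[ℂ] ℂ

/-- The inclusion `H ⊂ H₋`: the vector `h` is the functional `f ↦ (h, f)`.  (Mathlib's inner
product is antilinear in its first argument, so this is `inner ℂ f h`.) -/
def HMinus.ofH (A : H →ₗ.[ℂ] H) (h : H) : HMinus A :=
  LinearMap.mkContinuous
    { toFun := fun f => inner ℂ (HPlus.incl A f) h
      map_add' := fun f g => by rw [map_add, inner_add_left]
      map_smul' := fun c f => by rw [map_smul, inner_smul_left]; rfl }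
    ‖h‖ (fun f => by
      have h1 := norm_inner_le_norm (𝕜 := ℂ) (HPlus.incl A f) h
      have h2 := mul_le_mul_of_nonneg_right (HPlus.norm_incl_le A f) (norm_nonneg h)
      calc ‖(inner ℂ (HPlus.incl A f) h : ℂ)‖ ≤ ‖f‖ * ‖h‖ := h1.trans h2
        _ = ‖h‖ * ‖f‖ := mul_comm _ _)

@[simp] theorem HMinus.ofH_apply (A : H →ₗ.[ℂ] H) (h : H) (f : HPlus A) :
    HMinus.ofH A h f = inner ℂ (HPlus.incl A f) h := rfl

/-- The space `[H₊, H₋]` of bounded operators from `H₊` to `H₋`. -/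
abbrev BiOp (A : H →ₗ.[ℂ] H) : Type _ := HPlus A →L[ℂ] HMinus A

/-- The adjoint `B* ∈ [H₊, H₋]` of `B ∈ [H₊, H₋]`: `(B* f, g)` is the complex conjugate of
`(B g, f)`. -/
def BiOp.adj {A : H →ₗ.[ℂ] H} (B : BiOp A) : BiOp A :=
  LinearMap.mkContinuous₂
    (LinearMap.mk₂'ₛₗ (RingHom.id ℂ) (starRingEnd ℂ) (fun f g : HPlus A => conj (B g f))
      (fun f f' g => by simp) (fun c f g => by simp) (fun f g g' => by simp)
      (fun c f g => by simp))
    ‖B‖ (fun f g => by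
      have h1 : ‖B g f‖ ≤ ‖B‖ * ‖g‖ * ‖f‖ := B.le_opNorm₂ g f
      calc ‖conj (B g f)‖ = ‖B g f‖ := RCLike.norm_conj _
        _ ≤ ‖B‖ * ‖f‖ * ‖g‖ := by linarith [mul_right_comm ‖B‖ ‖g‖ ‖f‖])

@[simp] theorem BiOp.adj_apply {A : H →ₗ.[ℂ] H} (B : BiOp A) (f g : HPlus A) :
    B.adj f g = conj (B g f) := rfl

/-- `Re B = (B + B*) / 2`. -/
def BiOp.re {A : H →ₗ.[ℂ] H} (B : BiOp A) : BiOp A := (1 / 2 : ℂ) • (B + B.adj)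

/-- `Im B = (B - B*) / (2 i)`. -/
def BiOp.im {A : H →ₗ.[ℂ] H} (B : BiOp A) : BiOp A :=
  (1 / (2 * Complex.I) : ℂ) • (B - B.adj)

/-- `B ⊃ S`, for `B ∈ [H₊, H₋]` and an operator `S` in `H`. -/
def BiOp.Extends {A : H →ₗ.[ℂ] H} (B : BiOp A) (S : H →ₗ.[ℂ] H) : Prop :=
  S.domain ≤ A.adjoint.domain ∧
    ∀ (f : HPlus A) (hf : HPlus.incl A f ∈ S.domain),
      B f = HMinus.ofH A (S ⟨HPlus.incl A f, hf⟩)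

/-- The graph of the part of `B` in `H`: the pairs `(f, h)` with `f ∈ H₊` and `B f = h ∈ H`. -/
def BiOp.partGraph {A : H →ₗ.[ℂ] H} (B : BiOp A) : Submodule ℂ (H × H) where
  carrier := {p | ∃ f : HPlus A, HPlus.incl A f = p.1 ∧ B f = HMinus.ofH A p.2}
  zero_mem' := ⟨0, by simp, by ext g; simp⟩
  add_mem' := by
    rintro p q ⟨f, hf, hf'⟩ ⟨g, hg, hg'⟩
    exact ⟨f + g, by simp [hf, hg], by ext k; simp [hf', hg', inner_add_right]⟩
  smul_mem' := by
    rintro c p ⟨f, hf, hf'⟩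
    exact ⟨c • f, by simp [hf], by ext k; simp [hf', inner_smul_right]⟩

/-- The quasi-kernel of `B`: the operator in `H` with domain `{f ∈ H₊ : B f ∈ H}` that acts
there as `B`. -/
def BiOp.quasiKernel {A : H →ₗ.[ℂ] H} (B : BiOp A) : H →ₗ.[ℂ] H := B.partGraph.toLinearPMap

/-- When `H₊` is dense in `H`, the quasi-kernel is the operator whose graph is `partGraph`. -/
theorem BiOp.quasiKernel_graph {A : H →ₗ.[ℂ] H} (hA : Dense (A.adjoint.domain : Set H))
    (B : BiOp A) : B.quasiKernel.graph = B.partGraph := by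
  refine Submodule.toLinearPMap_graph_eq _ ?_
  rintro ⟨x, y⟩ ⟨f, hf, hf'⟩ hx
  simp only at hx hf hf' ⊢
  have h0 : f = 0 := HPlus.incl_injective A (by rw [hf, hx, map_zero])
  refine hA.eq_zero_of_inner_right ℂ fun g hg => ?_
  have := DFunLike.congr_fun hf' (HPlus.mk g hg)
  rw [h0, map_zero, HMinus.ofH_apply] at this
  exact this.symm

/-- The operator `B - z I ∈ [H₊, H₋]`, as a map. -/
def BiOp.subScalar {A : H →ₗ.[ℂ] H} (B : BiOp A) (z : ℂ) (f : HPlus A) : HMinus A :=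
  B f - z • HMinus.ofH A (HPlus.incl A f)

/-- `(B - z I)⁻¹ φ`: for injective `B - z I` and `φ` in its range, the unique `f ∈ H₊` with
`(B - z I) f = φ`. -/
def BiOp.resolvent {A : H →ₗ.[ℂ] H} (B : BiOp A) (z : ℂ) (φ : HMinus A) : HPlus A :=
  Function.invFun (B.subScalar z) φ

end Rigging

section Operators

variable {H : Type*} [NormedAddCommGroup H] [InnerProductSpace ℂ H] [CompleteSpace H]

/-- The resolvent set of an operator `T` in `H`: the `z` for which `T - z I` is a bijection of
`Dom T` onto `H` with bounded inverse `R`. -/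
def resolventSet (T : H →ₗ.[ℂ] H) : Set ℂ :=
  {z | ∃ R : H →L[ℂ] H,
    (∀ h : H, ∃ hR : R h ∈ T.domain, T ⟨R h, hR⟩ - z • R h = h) ∧
    ∀ f : T.domain, R (T f - z • (f : H)) = f}

/-- The deficiency subspace `ker (A* - w I)`. -/
def deficiencySpace (A : H →ₗ.[ℂ] H) (w : ℂ) : Submodule ℂ H :=
  (LinearMap.ker (A.adjoint.toFun - w • A.adjoint.domain.subtype)).map A.adjoint.domain.subtype

/-- `A` is a closed, densely defined, symmetric operator with equal finite deficiency indices. -/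
structure IsAdmissible (A : H →ₗ.[ℂ] H) : Prop where
  closed : A.IsClosed
  dense : Dense (A.domain : Set H)
  symmetric : A.IsFormalAdjoint A
  finite_pos : FiniteDimensional ℂ (deficiencySpace A Complex.I)
  finite_neg : FiniteDimensional ℂ (deficiencySpace A (-Complex.I))
  equal_indices : Module.finrank ℂ (deficiencySpace A Complex.I)
    = Module.finrank ℂ (deficiencySpace A (-Complex.I))

/-- `T` is a quasi-self-adjoint extension of `A`: a non-symmetric operator with
`A ⊂ T ⊂ A*`. -/
structure IsQuasiSelfAdjointExtension (A T : H →ₗ.[ℂ] H) : Prop where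
  le : A ≤ T
  le_adjoint : T ≤ A.adjoint
  not_symmetric : ¬ T.IsFormalAdjoint T

/-- The class `Λ(A)`. -/
structure IsClassLambda (A T : H →ₗ.[ℂ] H) : Prop extends IsQuasiSelfAdjointExtension A T where
  resolventSet_nonempty : (resolventSet T).Nonempty
  domain_eq : A.domain = T.domain ⊓ T.adjoint.domain

/-- `B` is a t-self-adjoint bi-extension of `A`: `B = B*`, `B ⊃ A`, and the quasi-kernel of `B`
is a self-adjoint operator in `H`. -/
structure IsTSelfAdjointBiExtension {A : H →ₗ.[ℂ] H} (B : BiOp A) : Prop where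
  selfAdjoint : B.adj = B
  ext : B.Extends A
  quasiKernel : IsSelfAdjoint B.quasiKernel

/-- `B` is a (*)-extension of `T`: `B ⊃ T ⊃ A`, `B* ⊃ T* ⊃ A`, and `Re B` is a t-self-adjoint
bi-extension of `A`. -/
structure IsStarExtension {A : H →ₗ.[ℂ] H} (T : H →ₗ.[ℂ] H) (B : BiOp A) : Prop where
  ext : B.Extends T
  le : A ≤ T
  ext_adjoint : B.adj.Extends T.adjoint
  le_adjoint : A ≤ T.adjoint
  re_tSelfAdjoint : IsTSelfAdjointBiExtension B.re

end Operators

section Systems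

variable {H : Type*} [NormedAddCommGroup H] [InnerProductSpace ℂ H] [CompleteSpace H]
variable {E : Type*} [NormedAddCommGroup E] [InnerProductSpace ℂ E] [CompleteSpace E]

/-- The adjoint `K* ∈ [H₊, E]` of `K ∈ [E, H₋]`. -/
def channelAdj {A : H →ₗ.[ℂ] H} (K : E →L[ℂ] HMinus A) : HPlus A →L[ℂ] E :=
  ((InnerProductSpace.toDual ℂ E).symm.toContinuousLinearEquiv :
    StrongDual ℂ E →L⋆[ℂ] E).comp K.flip

/-- `(e, K* f)_E = (K e, f)`. -/
theorem inner_channelAdj {A : H →ₗ.[ℂ] H} (K : E →L[ℂ] HMinus A) (f : HPlus A) (e : E) :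
    inner ℂ (channelAdj K f) e = K e f := by
  simp [channelAdj]

variable (H E) in
/-- An L-system with state space `H` and input-output space `E`: the operators `A` (symmetric),
`T` (main operator), `𝔸` (state-space operator), `K` (channel operator), `J` (direction
operator). -/
structure LSystem [FiniteDimensional ℂ E] where
  A : H →ₗ.[ℂ] H
  T : H →ₗ.[ℂ] H
  stateOp : BiOp A
  K : E →L[ℂ] HMinus A
  J : E →L[ℂ] E
  admissible : IsAdmissible A
  classLambda : IsClassLambda A T
  starExtension : IsStarExtension T stateOp
  J_selfAdjoint : IsSelfAdjoint J
  J_sq : J.comp J = ContinuousLinearMap.id ℂ E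
  im_eq : stateOp.im = (K.comp J).comp (channelAdj K)
  range_eq : Set.range K = Set.range stateOp.im

variable [FiniteDimensional ℂ E]

/-- The transfer function `W(z) = I - 2i K* (𝔸 - z I)⁻¹ K J`, for `z ∈ ρ(T)`. -/
def LSystem.transfer (Θ : LSystem H E) (z : ℂ) (e : E) : E :=
  e - (2 * Complex.I) • channelAdj Θ.K (Θ.stateOp.resolvent z (Θ.K (Θ.J e)))

/-- The impedance function `V(z) = K* (Re 𝔸 - z I)⁻¹ K`, for `z` in the resolvent set of the
quasi-kernel of `Re 𝔸` (which contains all non-real `z`). -/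
def LSystem.impedance (Θ : LSystem H E) (z : ℂ) (e : E) : E :=
  channelAdj Θ.K (Θ.stateOp.re.resolvent z (Θ.K e))

end Systems

section OneDimensional

variable {H : Type*} [NormedAddCommGroup H] [InnerProductSpace ℂ H] [CompleteSpace H]
variable {H' : Type*} [NormedAddCommGroup H'] [InnerProductSpace ℂ H'] [CompleteSpace H']

/-- For input-output space `ℂ`: the transfer function as a scalar function. -/
def LSystem.scalarTransfer (Θ : LSystem H ℂ) (z : ℂ) : ℂ := Θ.transfer z 1

/-- For input-output space `ℂ`: the impedance function as a scalar function. -/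
def LSystem.scalarImpedance (Θ : LSystem H ℂ) (z : ℂ) : ℂ := Θ.impedance z 1

/-- `Θ'` is a unimodular transformation of `Θ` with parameter `α ∈ [0, π)`:
`W_{Θ'}(z) = W_Θ(z) (-e^{2iα})` wherever both transfer functions are defined. -/
def IsUnimodularTransformation (Θ : LSystem H ℂ) (Θ' : LSystem H' ℂ) (α : ℝ) : Prop :=
  α ∈ Set.Ico 0 Real.pi ∧
    ∀ z ∈ resolventSet Θ.T ∩ resolventSet Θ'.T,
      Θ'.scalarTransfer z = Θ.scalarTransfer z * -Complex.exp (2 * Complex.I * α)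

/-- The perturbed Donoghue class `𝔐^Q`: Herglotz-Nevanlinna functions `V` on the upper half-plane
of the form `V(z) = Q + ∫ (1/(t - z) - t/(1 + t²)) dμ(t)` with an infinite Borel measure `μ` on
the real line such that `∫ dμ(t)/(1 + t²) = 1`. -/
def IsPerturbedDonoghue (Q : ℝ) (V : ℂ → ℂ) : Prop :=
  DifferentiableOn ℂ V {z | 0 < z.im} ∧
  (∀ z : ℂ, 0 < z.im → 0 ≤ (V z).im) ∧
  ∃ μ : Measure ℝ, μ Set.univ = ∞ ∧
    ∫⁻ t : ℝ, ENNReal.ofReal (1 / (1 + t ^ 2)) ∂μ = 1 ∧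
    ∀ z : ℂ, 0 < z.im →
      V z = Q + ∫ t : ℝ, (1 / ((t : ℂ) - z) - (t : ℂ) / (1 + (t : ℂ) ^ 2)) ∂μ

end OneDimensional

end LSys

end

/-! The operator theory enters only through scalar identities. Since `J = I`, 𝔸 is a rank-one
perturbation of Re 𝔸, so W = (1 - iV)/(1 + iV) in the lower half-plane, which lies in ρ(T) because T
is maximal dissipative (`scalarTransfer_eq`, `mem_resolventSet_T`). Multiplying W by -e^{2iα}
becomes a real Möbius transformation V' = (c + sV)/(s - cV) with c = cos α, s = sin α, and the
symmetry V(z̄) = conj V(z) carries it to the upper half-plane (`impedance_eq`).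

Membership in 𝔐^Q forces V(i) = Q + i (`IsPerturbedDonoghue.apply_I`). If also V'(i) = -Q + i,
comparing imaginary parts at i gives |s - c(Q + i)| = 1, that is cQ(2s - Qc) = 0, hence tan α = Q/2.

Conversely, tan α = Q/2 gives V'(i) = -Q + i, and what remains is that V' has a representation with
no linear term and with an infinite measure (`IsPerturbedDonoghue.of_moebius`). The representation
is Nevanlinna's theorem, obtained from Herglotz's theorem on the disc by a Cayley transform. The
rest is growth on the imaginary axis: the infinite measure of V makes y Im V(iy) unbounded, while Im
V(iy) = o(y). A linear term in V', or a finite measure for V', would contradict one of these facts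
through the Möbius relation. -/

namespace LinearPMap

/-! ### Symmetric and self-adjoint operators at non-real points -/

variable {H : Type*} [NormedAddCommGroup H] [InnerProductSpace ℂ H]

/-- Lower bound for a symmetric operator minus a scalar. -/
theorem IsFormalAdjoint.abs_im_mul_norm_le {S : H →ₗ.[ℂ] H} (hS : S.IsFormalAdjoint S) (z : ℂ)
    (f : S.domain) : |z.im| * ‖(f : H)‖ ≤ ‖S f - z • (f : H)‖ := by
  have h1 : (inner ℂ (f : H) (S f)).im = 0 := by
    have h := congrArg Complex.im (inner_conj_symm (𝕜 := ℂ) (f : H) (S f))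
    rw [hS f f, Complex.conj_im] at h
    linarith
  have h2 : (inner ℂ (f : H) (S f - z • (f : H))).im = -(z.im * ‖(f : H)‖ ^ 2) := by
    rw [inner_sub_right, inner_smul_right, inner_self_eq_norm_sq_to_K, Complex.sub_im, h1]
    simp [← Complex.ofReal_pow]
  have h3 : |z.im| * ‖(f : H)‖ ^ 2 ≤ ‖(f : H)‖ * ‖S f - z • (f : H)‖ := by
    calc |z.im| * ‖(f : H)‖ ^ 2 = |(inner ℂ (f : H) (S f - z • (f : H))).im| := by
          rw [h2, abs_neg, abs_mul, abs_of_nonneg (sq_nonneg ‖(f : H)‖)]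
      _ ≤ ‖(inner ℂ (f : H) (S f - z • (f : H)) : ℂ)‖ := Complex.abs_im_le_norm _
      _ ≤ _ := norm_inner_le_norm _ _
  rcases (norm_nonneg (f : H)).eq_or_lt with h | h
  · rw [← h, mul_zero]; exact norm_nonneg _
  · refine le_of_mul_le_mul_left ?_ h
    linarith

variable [CompleteSpace H]

theorem _root_.IsSelfAdjoint.isFormalAdjoint {S : H →ₗ.[ℂ] H} (hS : IsSelfAdjoint S) :
    S.IsFormalAdjoint S := by
  have h := adjoint_isFormalAdjoint hS.dense_domain
  rwa [isSelfAdjoint_def.1 hS] at h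

/-- A self-adjoint operator minus a non-real scalar is onto. -/
theorem _root_.IsSelfAdjoint.exists_apply_sub_smul_eq {S : H →ₗ.[ℂ] H} (hS : IsSelfAdjoint S)
    {z : ℂ} (hz : z.im ≠ 0) (h : H) : ∃ f : S.domain, S f - z • (f : H) = h := by
  have hsym := hS.isFormalAdjoint
  have hcl : _root_.IsClosed (S.graph : Set (H × H)) := hS.isClosed
  have : CompleteSpace S.graph := hcl.completeSpace_coe
  let Φ : S.graph →L[ℂ] H :=
    (ContinuousLinearMap.snd ℂ H H - z • ContinuousLinearMap.fst ℂ H H).comp S.graph.subtypeL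
  have hΦ (p : S.graph) : Φ p = p.1.2 - z • p.1.1 := rfl
  have hz' : 0 < |z.im| := abs_pos.2 hz
  -- The constant adds the bound 1/|Im z| for the first coordinate to the bound 1 + |z|/|Im z| for
  -- the second. Being bounded below on a complete graph, `Φ` has closed range.
  have hb : ∀ p : S.graph, ‖p‖ ≤ (Real.toNNReal (1 + (1 + ‖z‖) / |z.im|) : ℝ) * ‖Φ p‖ := by
    rintro ⟨⟨a, b⟩, hp⟩
    obtain ⟨f, rfl, rfl⟩ := (mem_graph_iff S).1 hp
    have h1 := hsym.abs_im_mul_norm_le z f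
    rw [Real.coe_toNNReal _ (by positivity), hΦ]
    have h2 : ‖(f : H)‖ ≤ ‖S f - z • (f : H)‖ / |z.im| := by
      rw [le_div_iff₀ hz']; linarith
    have h3 : ‖S f‖ ≤ ‖S f - z • (f : H)‖ + ‖z‖ * ‖(f : H)‖ := by
      rw [← norm_smul]; simpa using norm_add_le (S f - z • (f : H)) (z • (f : H))
    have h4 : ‖z‖ * ‖(f : H)‖ ≤ ‖z‖ * (‖S f - z • (f : H)‖ / |z.im|) :=
      mul_le_mul_of_nonneg_left h2 (norm_nonneg _)
    have h5 : (1 + (1 + ‖z‖) / |z.im|) * ‖S f - z • (f : H)‖ = ‖S f - z • (f : H)‖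
      + ‖S f - z • (f : H)‖ / |z.im| + ‖z‖ * (‖S f - z • (f : H)‖ / |z.im|) := by ring
    change max ‖(f : H)‖ ‖S f‖ ≤ (1 + (1 + ‖z‖) / |z.im|) * ‖S f - z • (f : H)‖
    rw [h5]
    have h6 := norm_nonneg (S f - z • (f : H))
    have h7 : 0 ≤ ‖S f - z • (f : H)‖ / |z.im| := by positivity
    have h8 : 0 ≤ ‖z‖ * (‖S f - z • (f : H)‖ / |z.im|) := by positivity
    exact max_le (by linarith) (by linarith)
  have hclosed : _root_.IsClosed (Set.range Φ) :=
    (ContinuousLinearMap.antilipschitz_of_bound Φ hb).isClosed_range Φ.uniformContinuous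
  have hclosed' : _root_.IsClosed (Φ.range : Set H) := by
    rw [LinearMap.coe_range]; exact hclosed
  have : CompleteSpace Φ.range := hclosed'.completeSpace_coe
  have htop : Φ.range = ⊤ := by
    rw [← Submodule.orthogonal_eq_bot_iff, Submodule.eq_bot_iff]
    intro g hg
    -- A vector orthogonal to the range is an eigenvector of S* = S for z̄, which the lower bound at
    -- z̄ excludes.
    have hg' : ∀ f : S.domain, inner ℂ (conj z • g) (f : H) = inner ℂ g (S f) := by
      intro f
      have h1 : inner ℂ (S f - z • (f : H)) g = 0 :=
        (Submodule.mem_orthogonal _ _).1 hg _ ⟨⟨(f, S f), mem_graph S f⟩, rfl⟩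
      rw [inner_eq_zero_symm, inner_sub_right, inner_smul_right, sub_eq_zero] at h1
      rw [inner_smul_left, Complex.conj_conj, h1]
    have hmem : g ∈ S.adjoint.domain := mem_adjoint_domain_of_exists g ⟨_, hg'⟩
    have happ := adjoint_apply_eq hS.dense_domain ⟨g, hmem⟩ hg'
    have hmem' : (g, conj z • g) ∈ S.graph := by
      rw [← isSelfAdjoint_def.1 hS, mem_graph_iff]
      exact ⟨⟨g, hmem⟩, rfl, happ⟩
    obtain ⟨f, hf1, hf2⟩ := (mem_graph_iff S).1 hmem'
    have h1 := hsym.abs_im_mul_norm_le (conj z) f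
    rw [hf1] at h1
    simp only at hf2
    rw [hf2, sub_self, norm_zero, Complex.conj_im, abs_neg] at h1
    exact norm_eq_zero.1 (le_antisymm (by nlinarith [norm_nonneg g]) (norm_nonneg g))
  obtain ⟨⟨⟨a, b⟩, hp⟩, hx⟩ : h ∈ Φ.range := htop ▸ Submodule.mem_top
  obtain ⟨f, rfl, rfl⟩ := (mem_graph_iff S).1 hp
  exact ⟨f, hx⟩

end LinearPMap

/-! ### Bi-extensions on the rigging -/

namespace LSys

section Rigging

variable {H : Type*} [NormedAddCommGroup H] [InnerProductSpace ℂ H] [CompleteSpace H]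
variable {A : H →ₗ.[ℂ] H}

theorem HMinus.ofH_add (x y : H) : HMinus.ofH A (x + y) = HMinus.ofH A x + HMinus.ofH A y := by
  ext f; simp [inner_add_right]

theorem HMinus.ofH_sub (x y : H) : HMinus.ofH A (x - y) = HMinus.ofH A x - HMinus.ofH A y := by
  ext f; simp [inner_sub_right]

theorem HMinus.ofH_smul (c : ℂ) (x : H) : HMinus.ofH A (c • x) = c • HMinus.ofH A x := by
  ext f; simp [inner_smul_right]

theorem BiOp.subScalar_sub (B : BiOp A) (z : ℂ) (f g : HPlus A) :
    B.subScalar z (f - g) = B.subScalar z f - B.subScalar z g := by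
  simp only [BiOp.subScalar, map_sub, HMinus.ofH_sub, smul_sub]; abel

theorem BiOp.subScalar_add (B : BiOp A) (z : ℂ) (f g : HPlus A) :
    B.subScalar z (f + g) = B.subScalar z f + B.subScalar z g := by
  simp only [BiOp.subScalar, map_add, HMinus.ofH_add, smul_add]; abel

theorem BiOp.subScalar_smul (B : BiOp A) (z c : ℂ) (f : HPlus A) :
    B.subScalar z (c • f) = c • B.subScalar z f := by
  simp only [BiOp.subScalar, map_smul, HMinus.ofH_smul, smul_sub, smul_comm c z]

theorem BiOp.subScalar_apply_apply (B : BiOp A) (z : ℂ) (f g : HPlus A) :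
    B.subScalar z f g = B f g - z * inner ℂ (HPlus.incl A g) (HPlus.incl A f) := by
  simp [BiOp.subScalar]

theorem BiOp.injective_subScalar_of_forall {B : BiOp A} {z : ℂ}
    (h : ∀ f, B.subScalar z f = 0 → f = 0) : Function.Injective (B.subScalar z) := by
  intro f g hfg
  rw [← sub_eq_zero]
  exact h _ (by rw [BiOp.subScalar_sub, hfg, sub_self])

theorem BiOp.resolvent_eq {B : BiOp A} {z : ℂ} (hB : Function.Injective (B.subScalar z))
    {f : HPlus A} {φ : HMinus A} (h : B.subScalar z f = φ) : B.resolvent z φ = f := by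
  rw [← h]
  exact Function.leftInverse_invFun hB f

/-- The imaginary part of the quadratic form of `B - z I`, for `B = B*`. -/
theorem BiOp.im_subScalar_apply_self {B : BiOp A} (hB : B.adj = B) (z : ℂ) (f : HPlus A) :
    (B.subScalar z f f).im = -(z.im * ‖HPlus.incl A f‖ ^ 2) := by
  have h1 : (B f f).im = 0 := by
    have h := congrArg Complex.im (DFunLike.congr_fun (DFunLike.congr_fun hB f) f)
    rw [BiOp.adj_apply, Complex.conj_im] at h
    linarith
  rw [BiOp.subScalar_apply_apply, inner_self_eq_norm_sq_to_K, Complex.sub_im, h1]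
  simp [← Complex.ofReal_pow]

theorem HPlus.eq_zero_of_norm_incl {f : HPlus A} (h : ‖HPlus.incl A f‖ ^ 2 = 0) : f = 0 :=
  HPlus.incl_injective A (by rw [map_zero]; simpa using h)

/-- The symmetry relation between `B - z I` and `B - conj z I`, for `B = B*`. -/
theorem BiOp.subScalar_symm {B : BiOp A} (hB : B.adj = B) (z : ℂ) (f g : HPlus A) :
    B.subScalar (conj z) f g = conj (B.subScalar z g f) := by
  rw [BiOp.subScalar_apply_apply, BiOp.subScalar_apply_apply, map_sub, map_mul, inner_conj_symm,
    ← BiOp.adj_apply, hB]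

theorem BiOp.re_adj (B : BiOp A) : B.re.adj = B.re := by
  ext f g
  have h2 : conj (2 : ℂ) = 2 := Complex.conj_ofNat 2
  simp [BiOp.re, h2, add_comm]

theorem BiOp.eq_re_add_im (B : BiOp A) : B = B.re + Complex.I • B.im := by
  ext f g
  simp only [BiOp.re, BiOp.im, add_apply, smul_apply, sub_apply, smul_eq_mul]
  field_simp
  ring

theorem BiOp.adj_eq_re_sub_im (B : BiOp A) : B.adj = B.re - Complex.I • B.im := by
  ext f g
  simp only [BiOp.re, BiOp.im, add_apply, smul_apply, sub_apply, smul_eq_mul]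
  field_simp
  ring

theorem BiOp.exists_of_mem_quasiKernel {B : BiOp A} (hA : Dense (A.adjoint.domain : Set H))
    (f : B.quasiKernel.domain) :
    ∃ g : HPlus A, HPlus.incl A g = f ∧ B g = HMinus.ofH A (B.quasiKernel f) := by
  have h := LinearPMap.mem_graph B.quasiKernel f
  rw [BiOp.quasiKernel_graph hA] at h
  exact h

theorem IsAdmissible.dense_adjoint_domain (hA : IsAdmissible A) :
    Dense (A.adjoint.domain : Set H) :=
  hA.dense.mono (LinearPMap.IsFormalAdjoint.le_adjoint hA.dense hA.symmetric).1

/-- For a t-self-adjoint bi-extension `B` and a non-real `z`, the range of `B - z I` contains `H`. -/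
theorem IsTSelfAdjointBiExtension.exists_subScalar_eq_ofH {B : BiOp A}
    (hB : IsTSelfAdjointBiExtension B) (hA : IsAdmissible A) {z : ℂ} (hz : z.im ≠ 0) (h : H) :
    ∃ f : HPlus A, B.subScalar z f = HMinus.ofH A h := by
  obtain ⟨f, hf⟩ := hB.quasiKernel.exists_apply_sub_smul_eq hz h
  obtain ⟨g, hg, hg'⟩ := BiOp.exists_of_mem_quasiKernel hA.dense_adjoint_domain f
  refine ⟨g, ?_⟩
  rw [BiOp.subScalar, hg, hg', ← HMinus.ofH_smul, ← HMinus.ofH_sub, hf]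

/-- The form of B is real, so a kernel vector f satisfies Im z · ‖f‖² = 0 in the norm of H, and H₊
embeds injectively in H. Self-adjointness of the quasi-kernel plays no role here; it matters for
surjectivity. -/
theorem BiOp.injective_subScalar {B : BiOp A} (hB : B.adj = B) {z : ℂ} (hz : z.im ≠ 0) :
    Function.Injective (B.subScalar z) := by
  refine BiOp.injective_subScalar_of_forall fun f hf => HPlus.eq_zero_of_norm_incl ?_
  have h := BiOp.im_subScalar_apply_self hB z f
  rw [hf] at h
  have h' : z.im * ‖HPlus.incl A f‖ ^ 2 = 0 := by
    have : ((0 : HMinus A) f).im = 0 := rfl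
    linarith
  exact (mul_eq_zero.1 h').resolve_left hz

end Rigging

/-! ### Resolvent points of the main operator -/

section Resolvent

variable {H : Type*} [NormedAddCommGroup H] [InnerProductSpace ℂ H] [CompleteSpace H]

/-- If `z₀ ∈ ρ(T)`, a vector `g` on which `T* - conj z₀` acts weakly like an element of `H` lies in
`Dom T`; that is, `T** ⊂ T`. -/
theorem mem_domain_of_forall_inner_adjoint {T : H →ₗ.[ℂ] H} (hT : Dense (T.domain : Set H))
    {z₀ : ℂ} (hz₀ : z₀ ∈ resolventSet T) {g h : H}
    (hg : ∀ f : T.adjoint.domain, inner ℂ (f : H) h = inner ℂ (T.adjoint f) g) :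
    ∃ hg : g ∈ T.domain, T ⟨g, hg⟩ = h := by
  obtain ⟨R, hR1, hR2⟩ := hz₀
  obtain ⟨hu, hu'⟩ := hR1 (h - z₀ • g)
  generalize R (h - z₀ • g) = u at hu hu'
  -- The solution is the adjoint of `R` applied to k: adjoints of inverses invert adjoints.
  have hadj : ∀ k : H, ∃ f : T.adjoint.domain, T.adjoint f - conj z₀ • (f : H) = k := by
    intro k
    have h1 : ∀ x : T.domain, inner ℂ (k + conj z₀ • ContinuousLinearMap.adjoint R k) (x : H)
        = inner ℂ (ContinuousLinearMap.adjoint R k) (T x) := by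
      intro x
      have h2 := congrArg (inner ℂ k) (hR2 x)
      rw [map_sub, map_smul, inner_sub_right, inner_smul_right] at h2
      rw [inner_add_left, inner_smul_left, Complex.conj_conj,
        ContinuousLinearMap.adjoint_inner_left, ContinuousLinearMap.adjoint_inner_left, ← h2]
      ring
    refine ⟨⟨_, LinearPMap.mem_adjoint_domain_of_exists _ ⟨_, h1⟩⟩, ?_⟩
    rw [LinearPMap.adjoint_apply_eq hT _ h1]
    simp
  -- The difference g - u is orthogonal to the range of T* - z̄₀, which is all of H by `hadj`.
  have hw : g - u = 0 := by
    obtain ⟨f, hf⟩ := hadj (g - u)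
    have h3 : inner ℂ (T.adjoint f) u = inner ℂ (f : H) (T ⟨u, hu⟩) :=
      LinearPMap.adjoint_isFormalAdjoint hT f ⟨u, hu⟩
    have h4 : inner ℂ (T.adjoint f - conj z₀ • (f : H)) (g - u) = 0 := by
      have h5 : T ⟨u, hu⟩ = h - z₀ • g + z₀ • u := by rw [← hu']; abel
      rw [h5, inner_add_right, inner_sub_right, inner_smul_right, inner_smul_right] at h3
      rw [inner_sub_left, inner_sub_right, inner_sub_right, inner_smul_left, inner_smul_left,
        Complex.conj_conj, ← hg, h3]
      ring
    rw [hf] at h4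
    exact inner_self_eq_zero.1 h4
  have hgu : g = u := sub_eq_zero.1 hw
  subst hgu
  exact ⟨hu, sub_left_injective hu'⟩

end Resolvent

section Bound

variable {H : Type*} [NormedAddCommGroup H] [InnerProductSpace ℂ H]

/-- A sufficient condition for `z ∈ ρ(T)`: `T - z I` is onto and bounded below. -/
theorem mem_resolventSet_of_bound {T : H →ₗ.[ℂ] H} {z : ℂ} {c : ℝ} (hc : 0 < c)
    (hb : ∀ f : T.domain, c * ‖(f : H)‖ ≤ ‖T f - z • (f : H)‖)
    (hs : ∀ h : H, ∃ f : T.domain, T f - z • (f : H) = h) : z ∈ resolventSet T := by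
  let L : T.domain →ₗ[ℂ] H := T.toFun - z • T.domain.subtype
  have hL (f : T.domain) : L f = T f - z • (f : H) := rfl
  have hinj : Function.Injective L := by
    rw [← LinearMap.ker_eq_bot, LinearMap.ker_eq_bot']
    intro f hf
    have h := hb f
    rw [← hL, hf, norm_zero] at h
    exact Subtype.ext (norm_eq_zero.1 (le_antisymm (by nlinarith [norm_nonneg (f : H)])
      (norm_nonneg (f : H))))
  let e := LinearEquiv.ofBijective L ⟨hinj, hs⟩
  have he (h : H) : L (e.symm h) = h := e.apply_symm_apply h
  refine ⟨(T.domain.subtype.comp e.symm.toLinearMap).mkContinuous c⁻¹ fun h => ?_, fun h => ?_,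
    fun f => ?_⟩
  · have h1 := hb (e.symm h)
    rw [← hL, he] at h1
    rw [← div_eq_inv_mul, le_div_iff₀ hc, mul_comm]
    exact h1
  · exact ⟨(e.symm h).2, he h⟩
  · change ((e.symm (L f) : T.domain) : H) = f
    rw [show e.symm (L f) = f from e.symm_apply_apply f]

end Bound

/-! ### Impedance and transfer functions of scattering L-systems -/

namespace LSystem

variable {H : Type*} [NormedAddCommGroup H] [InnerProductSpace ℂ H] [CompleteSpace H]
variable (Θ : LSystem H ℂ)

/-- The channel vector `K 1 ∈ H₋`. -/
noncomputable def channelVec : HMinus Θ.A := Θ.K 1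

/-- The functional `K*` on `H₊`. -/
noncomputable def channelFun : HPlus Θ.A →L[ℂ] ℂ := channelAdj Θ.K

theorem conj_channelFun (f : HPlus Θ.A) : conj (Θ.channelFun f) = Θ.channelVec f := by
  have h := inner_channelAdj Θ.K f 1
  rw [RCLike.inner_apply, one_mul] at h
  exact h

theorem channelFun_eq (f : HPlus Θ.A) : Θ.channelFun f = conj (Θ.channelVec f) := by
  rw [← conj_channelFun, Complex.conj_conj]

theorem K_apply (c : ℂ) : Θ.K c = c • Θ.channelVec := by
  rw [channelVec, ← map_smul, smul_eq_mul, mul_one]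

variable {Θ}

/-- Im 𝔸 = KK* has rank at most one, so every question about 𝔸 reduces to Re 𝔸 and the single vector
K1. -/
theorem stateOp_apply (hJ : Θ.J = ContinuousLinearMap.id ℂ ℂ) (f : HPlus Θ.A) :
    Θ.stateOp f = Θ.stateOp.re f + (Complex.I * Θ.channelFun f) • Θ.channelVec := by
  conv_lhs => rw [Θ.stateOp.eq_re_add_im, Θ.im_eq, hJ]
  rw [mul_smul, ← K_apply]
  rfl

theorem adj_stateOp_apply (hJ : Θ.J = ContinuousLinearMap.id ℂ ℂ) (f : HPlus Θ.A) :
    Θ.stateOp.adj f = Θ.stateOp.re f - (Complex.I * Θ.channelFun f) • Θ.channelVec := by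
  conv_lhs => rw [Θ.stateOp.adj_eq_re_sub_im, Θ.im_eq, hJ]
  rw [mul_smul, ← K_apply]
  rfl

theorem stateOp_subScalar (hJ : Θ.J = ContinuousLinearMap.id ℂ ℂ) (z : ℂ) (f : HPlus Θ.A) :
    Θ.stateOp.subScalar z f
      = Θ.stateOp.re.subScalar z f + (Complex.I * Θ.channelFun f) • Θ.channelVec := by
  rw [BiOp.subScalar, stateOp_apply hJ, BiOp.subScalar]; abel

variable (Θ) in
theorem dense_T_domain : Dense (Θ.T.domain : Set H) :=
  Θ.admissible.dense.mono Θ.classLambda.le.1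

/-- The functional `K*` does not vanish on `Dom T`. -/
theorem exists_channelFun_eq_one (hJ : Θ.J = ContinuousLinearMap.id ℂ ℂ) :
    ∃ f : HPlus Θ.A, HPlus.incl Θ.A f ∈ Θ.T.domain ∧ Θ.channelFun f = 1 := by
  by_contra! hcon
  have h0 : ∀ f : HPlus Θ.A, HPlus.incl Θ.A f ∈ Θ.T.domain → Θ.channelFun f = 0 := by
    intro f hf
    by_contra hne
    refine hcon ((Θ.channelFun f)⁻¹ • f) ?_ ?_
    · rw [map_smul]; exact Submodule.smul_mem _ _ hf
    · rw [map_smul, smul_eq_mul, inv_mul_cancel₀ hne]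
  -- If K* vanished on Dom T, then 𝔸 and 𝔸* would both act there as T, and T would be symmetric.
  refine Θ.classLambda.not_symmetric fun x y => ?_
  have hsub := Θ.starExtension.ext.1
  have hx : Θ.stateOp (HPlus.mk x (hsub x.2)) = HMinus.ofH Θ.A (Θ.T x) :=
    Θ.starExtension.ext.2 (HPlus.mk x (hsub x.2)) x.2
  have hy : Θ.stateOp (HPlus.mk y (hsub y.2)) = HMinus.ofH Θ.A (Θ.T y) :=
    Θ.starExtension.ext.2 (HPlus.mk y (hsub y.2)) y.2
  have hy' : Θ.stateOp.adj (HPlus.mk y (hsub y.2)) = HMinus.ofH Θ.A (Θ.T y) := by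
    rw [← hy, adj_stateOp_apply hJ, stateOp_apply hJ, h0 _ y.2]
    ext g
    simp
  have h1 := DFunLike.congr_fun hy' (HPlus.mk (x : H) (hsub x.2))
  rw [BiOp.adj_apply, hx, HMinus.ofH_apply, HMinus.ofH_apply, inner_conj_symm] at h1
  exact h1

/-- For non-real `z`, the channel vector lies in the range of `Re 𝔸 - z I`. -/
theorem exists_subScalar_eq_channelVec (hJ : Θ.J = ContinuousLinearMap.id ℂ ℂ) {z : ℂ}
    (hz : z.im ≠ 0) : ∃ f : HPlus Θ.A, Θ.stateOp.re.subScalar z f = Θ.channelVec := by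
  obtain ⟨f, hf, hf1⟩ := exists_channelFun_eq_one hJ
  have hTf := Θ.starExtension.ext.2 f hf
  rw [stateOp_apply hJ, hf1, mul_one] at hTf
  obtain ⟨g, hg⟩ := Θ.starExtension.re_tSelfAdjoint.exists_subScalar_eq_ofH Θ.admissible hz
    (Θ.T ⟨HPlus.incl Θ.A f, hf⟩ - z • HPlus.incl Θ.A f)
  -- As K*f = 1 and 𝔸f = Tf, one has (Re 𝔸 - z)f = (T - z)f - iK1, while g solves (Re 𝔸 - z)g = (T -
  -- z)f. The difference leaves -iK1, and the factor i normalizes it.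
  refine ⟨Complex.I • f - Complex.I • g, ?_⟩
  rw [BiOp.subScalar_sub, BiOp.subScalar_smul, BiOp.subScalar_smul, hg, HMinus.ofH_sub,
    ← hTf, HMinus.ofH_smul, BiOp.subScalar]
  have hI : Complex.I • Complex.I • Θ.channelVec = -Θ.channelVec := by
    ext k
    simp [← mul_assoc]
  simp only [smul_sub, smul_add, hI]
  abel

theorem re_adj (Θ : LSystem H ℂ) : Θ.stateOp.re.adj = Θ.stateOp.re := BiOp.re_adj _

theorem scalarImpedance_eq {z : ℂ} (hz : z.im ≠ 0) {f : HPlus Θ.A}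
    (hf : Θ.stateOp.re.subScalar z f = Θ.channelVec) : Θ.scalarImpedance z = Θ.channelFun f := by
  have h := BiOp.resolvent_eq (BiOp.injective_subScalar Θ.re_adj hz) hf
  change channelAdj Θ.K (Θ.stateOp.re.resolvent z Θ.channelVec) = _
  rw [h]; rfl

theorem scalarImpedance_conj (hJ : Θ.J = ContinuousLinearMap.id ℂ ℂ) {z : ℂ} (hz : z.im ≠ 0) :
    Θ.scalarImpedance (conj z) = conj (Θ.scalarImpedance z) := by
  have hz' : (conj z).im ≠ 0 := by simpa using hz
  obtain ⟨f, hf⟩ := exists_subScalar_eq_channelVec hJ hz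
  obtain ⟨g, hg⟩ := exists_subScalar_eq_channelVec hJ hz'
  have h := BiOp.subScalar_symm Θ.re_adj z g f
  rw [hf, hg] at h
  rw [scalarImpedance_eq hz hf, scalarImpedance_eq hz' hg, conj_channelFun, channelFun_eq, h]

/-- If (Re 𝔸 - z)f = K1, then V(z) = K*f is the conjugate of ((Re 𝔸 - z)f, f), so r is ‖f‖² in H. -/
theorem scalarImpedance_im (hJ : Θ.J = ContinuousLinearMap.id ℂ ℂ) {z : ℂ} (hz : z.im ≠ 0) :
    ∃ r : ℝ, 0 ≤ r ∧ (Θ.scalarImpedance z).im = z.im * r := by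
  obtain ⟨f, hf⟩ := exists_subScalar_eq_channelVec hJ hz
  refine ⟨‖HPlus.incl Θ.A f‖ ^ 2, sq_nonneg _, ?_⟩
  rw [scalarImpedance_eq hz hf, channelFun_eq, ← hf, Complex.conj_im,
    BiOp.im_subScalar_apply_self Θ.re_adj, neg_neg]

/-- The rank-one term contributes i|K*f|². For Im z < 0 both summands are nonnegative, which is the
dissipativity behind injectivity and the resolvent bound. -/
theorem stateOp_im_subScalar_apply_self (hJ : Θ.J = ContinuousLinearMap.id ℂ ℂ) (z : ℂ)
    (f : HPlus Θ.A) : (Θ.stateOp.subScalar z f f).im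
      = -(z.im * ‖HPlus.incl Θ.A f‖ ^ 2) + ‖Θ.channelFun f‖ ^ 2 := by
  have h : ((Complex.I * Θ.channelFun f) • Θ.channelVec) f
      = Complex.I * (‖Θ.channelFun f‖ ^ 2 : ℝ) := by
    rw [smul_apply, ← conj_channelFun, smul_eq_mul, mul_assoc,
      Complex.mul_conj, Complex.normSq_eq_norm_sq]
  rw [stateOp_subScalar hJ, add_apply, Complex.add_im, h,
    BiOp.im_subScalar_apply_self Θ.re_adj, Complex.I_mul_im, Complex.ofReal_re]

theorem injective_stateOp_subScalar (hJ : Θ.J = ContinuousLinearMap.id ℂ ℂ) {z : ℂ}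
    (hz : z.im < 0) : Function.Injective (Θ.stateOp.subScalar z) := by
  refine BiOp.injective_subScalar_of_forall fun f hf => HPlus.eq_zero_of_norm_incl ?_
  have h := stateOp_im_subScalar_apply_self hJ z f
  rw [hf] at h
  have h0 : ((0 : HMinus Θ.A) f).im = 0 := rfl
  nlinarith [sq_nonneg ‖HPlus.incl Θ.A f‖, sq_nonneg ‖Θ.channelFun f‖]

/-- Vanishing would mean V(z) = i, but Im V ≤ 0 in the lower half-plane. -/
theorem one_add_I_mul_scalarImpedance_ne_zero (hJ : Θ.J = ContinuousLinearMap.id ℂ ℂ) {z : ℂ}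
    (hz : z.im < 0) : 1 + Complex.I * Θ.scalarImpedance z ≠ 0 := by
  intro h
  obtain ⟨r, hr, hr'⟩ := scalarImpedance_im hJ hz.ne
  have h1 := congrArg Complex.re h
  rw [Complex.add_re, Complex.I_mul_re, Complex.one_re, Complex.zero_re, hr'] at h1
  nlinarith

/-- `W = (1 - i V) / (1 + i V)` in the lower half-plane. -/
theorem scalarTransfer_eq (hJ : Θ.J = ContinuousLinearMap.id ℂ ℂ) {z : ℂ} (hz : z.im < 0) :
    Θ.scalarTransfer z
      = (1 - Complex.I * Θ.scalarImpedance z) / (1 + Complex.I * Θ.scalarImpedance z) := by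
  obtain ⟨f, hf⟩ := exists_subScalar_eq_channelVec hJ hz.ne
  have hne := one_add_I_mul_scalarImpedance_ne_zero hJ hz
  have hV := scalarImpedance_eq hz.ne hf
  -- Rank-one resolvent formula: (Re 𝔸 - z)f = K1 gives (𝔸 - z)f = (1 + iV)K1, so rescaling f
  -- inverts 𝔸 - z on K1.
  have h1 : Θ.stateOp.subScalar z ((1 + Complex.I * Θ.scalarImpedance z)⁻¹ • f)
      = Θ.channelVec := by
    rw [BiOp.subScalar_smul, stateOp_subScalar hJ, hf, ← hV]
    ext k
    simp only [smul_apply, add_apply, smul_eq_mul]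
    field_simp
  have h2 := BiOp.resolvent_eq (injective_stateOp_subScalar hJ hz) h1
  have h3 : Θ.scalarTransfer z = 1 - (2 * Complex.I) •
      Θ.channelFun (Θ.stateOp.resolvent z Θ.channelVec) := by
    change 1 - (2 * Complex.I) • channelAdj Θ.K (Θ.stateOp.resolvent z (Θ.K (Θ.J 1))) = _
    rw [hJ]; rfl
  rw [h3, h2, map_smul, ← hV]
  simp only [smul_eq_mul]
  field_simp
  ring

/-- The main operator of a scattering L-system is maximal dissipative. -/
theorem mem_resolventSet_T (hJ : Θ.J = ContinuousLinearMap.id ℂ ℂ) {z : ℂ} (hz : z.im < 0) :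
    z ∈ resolventSet Θ.T := by
  have hsub := Θ.starExtension.ext.1
  refine mem_resolventSet_of_bound (c := -z.im) (by linarith) (fun x => ?_) (fun h => ?_)
  · have hx : Θ.stateOp (HPlus.mk x (hsub x.2)) = HMinus.ofH Θ.A (Θ.T x) :=
      Θ.starExtension.ext.2 (HPlus.mk x (hsub x.2)) x.2
    have h1 := stateOp_im_subScalar_apply_self hJ z (HPlus.mk x (hsub x.2))
    rw [BiOp.subScalar, hx, ← HMinus.ofH_smul, ← HMinus.ofH_sub, HMinus.ofH_apply,
      HPlus.incl_mk] at h1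
    have h2 : (inner ℂ (x : H) (Θ.T x - z • (x : H))).im ≤ ‖(x : H)‖ * ‖Θ.T x - z • (x : H)‖ :=
      (Complex.im_le_norm _).trans (norm_inner_le_norm _ _)
    rcases (norm_nonneg (x : H)).eq_or_lt with h0 | h0
    · rw [← h0, mul_zero]; exact norm_nonneg _
    · refine le_of_mul_le_mul_left ?_ h0
      nlinarith [sq_nonneg ‖Θ.channelFun (HPlus.mk x (hsub x.2))‖]
  · obtain ⟨f, hf⟩ := exists_subScalar_eq_channelVec hJ hz.ne
    have hne := one_add_I_mul_scalarImpedance_ne_zero hJ hz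
    rw [scalarImpedance_eq hz.ne hf] at hne
    obtain ⟨g, hg⟩ := Θ.starExtension.re_tSelfAdjoint.exists_subScalar_eq_ofH Θ.admissible hz.ne h
    -- Chosen so that the multiples of K1 in (𝔸 - z)(g + cf) cancel and only h is left.
    set c : ℂ := -(Complex.I * Θ.channelFun g) / (1 + Complex.I * Θ.channelFun f) with hc
    have hu : Θ.stateOp.subScalar z (g + c • f) = HMinus.ofH Θ.A h := by
      have h2 : Complex.I * Θ.channelFun g + c * (1 + Complex.I * Θ.channelFun f) = 0 := by
        rw [hc, div_mul_cancel₀ _ hne]; ring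
      rw [BiOp.subScalar_add, BiOp.subScalar_smul, stateOp_subScalar hJ, stateOp_subScalar hJ, hg,
        hf, add_assoc]
      conv_rhs => rw [← add_zero (HMinus.ofH Θ.A h), ← zero_smul ℂ Θ.channelVec, ← h2]
      congr 1
      module
    set u := g + c • f
    have hu' : Θ.stateOp u = HMinus.ofH Θ.A (h + z • HPlus.incl Θ.A u) := by
      rw [HMinus.ofH_add, HMinus.ofH_smul, ← hu, BiOp.subScalar, sub_add_cancel]
    -- So far u is only in H₊ with 𝔸u in H. Pairing with Dom T* through 𝔸* ⊃ T* puts u in the domain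
    -- of T**, and a point of ρ(T) yields T** ⊂ T.
    obtain ⟨z₀, hz₀⟩ := Θ.classLambda.resolventSet_nonempty
    obtain ⟨hmem, happ⟩ := mem_domain_of_forall_inner_adjoint Θ.dense_T_domain hz₀
      (g := HPlus.incl Θ.A u) (h := h + z • HPlus.incl Θ.A u) (by
        intro y
        have hy' := Θ.starExtension.ext_adjoint.1 y.2
        have hy : Θ.stateOp.adj (HPlus.mk y hy') = HMinus.ofH Θ.A (Θ.T.adjoint y) :=
          Θ.starExtension.ext_adjoint.2 (HPlus.mk y hy') y.2
        have h3 := DFunLike.congr_fun hy u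
        rw [BiOp.adj_apply, hu', HMinus.ofH_apply, HMinus.ofH_apply, HPlus.incl_mk] at h3
        rw [← inner_conj_symm (Θ.T.adjoint y), ← h3, Complex.conj_conj])
    exact ⟨⟨_, hmem⟩, by rw [happ]; simp⟩

end LSystem

/-- V ↦ W is a Cayley transform, under which rotations of W become real Möbius maps of V. The lower
half-plane is used because it lies in both resolvent sets. -/
theorem IsUnimodularTransformation.impedance_eq_lower
    {H : Type*} [NormedAddCommGroup H] [InnerProductSpace ℂ H] [CompleteSpace H]
    {H' : Type*} [NormedAddCommGroup H'] [InnerProductSpace ℂ H'] [CompleteSpace H']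
    {Θ : LSystem H ℂ} (hJ : Θ.J = ContinuousLinearMap.id ℂ ℂ)
    {Θ' : LSystem H' ℂ} (hJ' : Θ'.J = ContinuousLinearMap.id ℂ ℂ) {α : ℝ}
    (hU : IsUnimodularTransformation Θ Θ' α) {z : ℂ} (hz : z.im < 0) :
    Θ'.scalarImpedance z * (Real.sin α - Real.cos α * Θ.scalarImpedance z)
      = Real.cos α + Real.sin α * Θ.scalarImpedance z := by
  have h := hU.2 z ⟨LSystem.mem_resolventSet_T hJ hz, LSystem.mem_resolventSet_T hJ' hz⟩
  rw [LSystem.scalarTransfer_eq hJ hz, LSystem.scalarTransfer_eq hJ' hz] at h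
  have h1 := LSystem.one_add_I_mul_scalarImpedance_ne_zero hJ hz
  have h2 := LSystem.one_add_I_mul_scalarImpedance_ne_zero hJ' hz
  set V := Θ.scalarImpedance z
  set V' := Θ'.scalarImpedance z
  rw [div_mul_eq_mul_div, div_eq_div_iff h2 h1] at h
  have he : Complex.exp (2 * Complex.I * α)
      = (Real.cos α + Real.sin α * Complex.I) * (Real.cos α + Real.sin α * Complex.I) := by
    rw [show 2 * Complex.I * (α : ℂ) = α * Complex.I + α * Complex.I by ring, Complex.exp_add,
      Complex.exp_mul_I, Complex.ofReal_cos, Complex.ofReal_sin]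
  rw [he] at h
  have hcs : (Real.cos α : ℂ) ^ 2 + (Real.sin α : ℂ) ^ 2 = 1 := by
    exact_mod_cast Real.cos_sq_add_sin_sq α
  have hI := Complex.I_sq
  generalize (Real.cos α : ℂ) = c at *
  generalize (Real.sin α : ℂ) = s at *
  -- The factor c - is = e^{-iα} splits the phase e^{2iα} evenly between the two sides, which makes
  -- the coefficients real.
  linear_combination (-(1 / 2) * (c - s * Complex.I)) * h
    + (1 / 2) * (c + s * Complex.I) * (1 - Complex.I * V) * (1 + Complex.I * V')
      * (hcs - s ^ 2 * hI) + (s * (V' - V) - c * V * V') * hI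

/-- The relation has real coefficients, so it survives reflection of both impedances in the real
axis. -/
theorem IsUnimodularTransformation.impedance_eq
    {H : Type*} [NormedAddCommGroup H] [InnerProductSpace ℂ H] [CompleteSpace H]
    {H' : Type*} [NormedAddCommGroup H'] [InnerProductSpace ℂ H'] [CompleteSpace H']
    {Θ : LSystem H ℂ} (hJ : Θ.J = ContinuousLinearMap.id ℂ ℂ)
    {Θ' : LSystem H' ℂ} (hJ' : Θ'.J = ContinuousLinearMap.id ℂ ℂ) {α : ℝ}
    (hU : IsUnimodularTransformation Θ Θ' α) {z : ℂ} (hz : 0 < z.im) :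
    Θ'.scalarImpedance z * (Real.sin α - Real.cos α * Θ.scalarImpedance z)
      = Real.cos α + Real.sin α * Θ.scalarImpedance z := by
  have h := hU.impedance_eq_lower hJ hJ' (z := conj z) (by simpa using hz)
  rw [LSystem.scalarImpedance_conj hJ hz.ne', LSystem.scalarImpedance_conj hJ' hz.ne'] at h
  have h' := congrArg conj h
  simpa [← Complex.ofReal_cos, ← Complex.ofReal_sin, Complex.conj_ofReal] using h'

end LSys

/-! ### Herglotz and Nevanlinna representations -/

section Herglotz

open Metric Filter Topology

/-- An analytic function with vanishing real part on a preconnected open set is constant. -/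
theorem AnalyticOnNhd.exists_eq_const_of_re_eq_zero {U : Set ℂ} {g : ℂ → ℂ}
    (hg : AnalyticOnNhd ℂ g U) (hU : IsPreconnected U) (hUo : IsOpen U)
    (hre : ∀ z ∈ U, (g z).re = 0) : ∃ w, ∀ z ∈ U, g z = w := by
  rcases hg.is_constant_or_isOpen hU with h | h
  · exact h
  · rcases U.eq_empty_or_nonempty with rfl | ⟨z₀, hz₀⟩
    · exact ⟨0, by simp⟩
    -- A nonconstant g would have open image, containing a real translate of g(z₀) off the imaginary
    -- axis.
    obtain ⟨ε, hε, hball⟩ := Metric.isOpen_iff.1 (h U subset_rfl hUo) _ (Set.mem_image_of_mem g hz₀)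
    obtain ⟨z, hz, hz'⟩ := hball (show g z₀ + (ε / 2 : ℝ) ∈ ball (g z₀) ε by
      rw [mem_ball_iff_norm, add_sub_cancel_left, Complex.norm_real, Real.norm_of_nonneg (by linarith)]
      linarith)
    have h1 := congrArg Complex.re hz'
    rw [hre z hz, Complex.add_re, hre z₀ hz₀, Complex.ofReal_re] at h1
    linarith

/-- A nonnegative continuous density of total mass one with respect to normalized arc length defines
a probability measure on the unit circle. -/
theorem exists_probabilityMeasure_sphere_of_density {p : ℂ → ℝ}
    (hp : ContinuousOn p (sphere 0 1)) (hp0 : ∀ ζ ∈ sphere (0 : ℂ) 1, 0 ≤ p ζ)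
    (hp1 : Real.circleAverage p 0 1 = 1) :
    ∃ σ : ProbabilityMeasure (sphere (0 : ℂ) 1), ∀ f : sphere (0 : ℂ) 1 → ℂ, Continuous f →
      ∀ g : ℂ → ℂ, (∀ ζ : sphere (0 : ℂ) 1, g ζ = f ζ) →
      ∫ ζ, f ζ ∂(σ : Measure (sphere (0 : ℂ) 1))
        = Real.circleAverage (fun ζ => g ζ • (p ζ : ℂ)) 0 1 := by
  have hmem (θ : ℝ) : circleMap 0 1 θ ∈ sphere (0 : ℂ) 1 := circleMap_mem_sphere 0 zero_le_one θ
  let e : ℝ → sphere (0 : ℂ) 1 := fun θ => ⟨circleMap 0 1 θ, hmem θ⟩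
  have he : Continuous e := (continuous_circleMap 0 1).subtype_mk _
  have hpc : Continuous fun θ => p (circleMap 0 1 θ) :=
    hp.comp_continuous (continuous_circleMap 0 1) hmem
  let d : ℝ → ℝ≥0∞ := fun θ => ENNReal.ofReal ((2 * Real.pi)⁻¹ * p (circleMap 0 1 θ))
  have hd : Measurable d := ENNReal.measurable_ofReal.comp (hpc.measurable.const_mul _)
  have hpos (θ : ℝ) : 0 ≤ (2 * Real.pi)⁻¹ * p (circleMap 0 1 θ) :=
    mul_nonneg (by positivity) (hp0 _ (hmem θ))
  let m : Measure (sphere (0 : ℂ) 1) :=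
    ((volume.restrict (Set.Ioc 0 (2 * Real.pi))).withDensity d).map e
  have hm : IsProbabilityMeasure m := by
    refine ⟨?_⟩
    rw [Measure.map_apply he.measurable MeasurableSet.univ, Set.preimage_univ,
      withDensity_apply _ MeasurableSet.univ, Measure.restrict_univ,
      ← ofReal_integral_eq_lintegral_ofReal]
    · rw [integral_const_mul, ← intervalIntegral.integral_of_le (by positivity), ← smul_eq_mul,
        ← Real.circleAverage_def, hp1, ENNReal.ofReal_one]
    · exact ((hpc.const_mul _).integrableOn_Icc).mono_set Set.Ioc_subset_Icc_self
    · exact Eventually.of_forall hpos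
  refine ⟨⟨m, hm⟩, fun f hf g hg => ?_⟩
  change ∫ ζ, f ζ ∂m = _
  rw [integral_map he.aemeasurable hf.aestronglyMeasurable,
    integral_withDensity_eq_integral_toReal_smul hd (Eventually.of_forall fun _ => by simp [d]),
    Real.circleAverage_def, intervalIntegral.integral_of_le (by positivity), ← integral_smul]
  refine integral_congr_ae (Eventually.of_forall fun θ => ?_)
  simp only [d, ENNReal.toReal_ofReal (hpos θ)]
  rw [← hg (e θ)]
  change ((2 * Real.pi)⁻¹ * p (circleMap 0 1 θ)) • g (circleMap 0 1 θ) = _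
  simp only [Complex.real_smul, smul_eq_mul]
  push_cast
  ring

/-- The Schwarz integral formula on the unit disc. -/
theorem DifferentiableOn.eq_circleAverage_herglotzRieszKernel {G : ℂ → ℂ} {R : ℝ} (hR : 1 < R)
    (hG : DifferentiableOn ℂ G (ball 0 R)) {w : ℂ} (hw : w ∈ ball (0 : ℂ) 1) :
    G w = (G 0).im * Complex.I
      + Real.circleAverage (fun ζ => herglotzRieszKernel 0 w ζ • ((G ζ).re : ℂ)) 0 1 := by
  have hsub : closedBall (0 : ℂ) 1 ⊆ ball 0 R := closedBall_subset_ball hR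
  have hdc : DiffContOnCl ℂ G (ball 0 1) :=
    DifferentiableOn.diffContOnCl (by rw [closure_ball _ one_ne_zero]; exact hG.mono hsub)
  have hGc : ContinuousOn G (sphere 0 1) :=
    hG.continuousOn.mono (sphere_subset_closedBall.trans hsub)
  have hint : CircleIntegrable (fun ζ => (G ζ).re) 0 1 :=
    (Complex.continuous_re.comp_continuousOn hGc).circleIntegrable zero_le_one
  have hint' : CircleIntegrable (fun ζ => ((G ζ).re : ℂ)) 0 1 :=
    ((Complex.continuous_ofReal.comp Complex.continuous_re).comp_continuousOn hGc).circleIntegrable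
      zero_le_one
  let S : ℂ → ℂ := fun w =>
    Real.circleAverage (fun ζ => herglotzRieszKernel 0 w ζ • ((G ζ).re : ℂ)) 0 1
  have hSa : AnalyticOnNhd ℂ S (ball 0 1) :=
    analyticOnNhd_circleAverage_herglotzRieszKernel_smul hint'
  have hGa : AnalyticOnNhd ℂ G (ball 0 1) :=
    (hG.mono (ball_subset_closedBall.trans hsub)).analyticOnNhd isOpen_ball
  -- The real part of the kernel is the Poisson kernel, so G and its Schwarz integral differ by an
  -- imaginary constant.
  have hre : ∀ z ∈ ball (0 : ℂ) 1, ((G - S) z).re = 0 := by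
    intro z hz
    have h1 := hdc.circleAverage_re_herglotzRieszKernel_smul hz
    have h2 := re_circleAverage_herglotzRieszKernel_smul hint hz
    have hint2 : CircleIntegrable ((Complex.re ∘ herglotzRieszKernel 0 z) • G) 0 1 := by
      refine ContinuousOn.circleIntegrable zero_le_one (ContinuousOn.smul ?_ hGc)
      have := continuousOn_herglotzRieszKernel_sphere hz
      rw [abs_one] at this
      exact Complex.continuous_re.comp_continuousOn this
    have h3 := Complex.reCLM.circleAverage_comp_comm hint2
    rw [h1] at h3
    rw [Pi.sub_apply, Complex.sub_re, sub_eq_zero, h2, ← Complex.reCLM_apply, ← h3]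
    refine Real.circleAverage_congr_sphere fun ζ _ => ?_
    simp
  obtain ⟨k, hk⟩ := (hGa.sub hSa).exists_eq_const_of_re_eq_zero
    (convex_ball (0 : ℂ) 1).isPreconnected isOpen_ball hre
  have h0 : (0 : ℂ) ∈ ball (0 : ℂ) 1 := mem_ball_self one_pos
  have hk0 := hk 0 h0
  have hkre : k.re = 0 := by rw [← hk0, hre 0 h0]
  -- At the centre the kernel is 1, so the Schwarz integral is a real average there and the constant
  -- is i Im G(0).
  have hS0 : (S 0).im = 0 := by
    have h4 : S 0 = Real.circleAverage (fun ζ => ((G ζ).re : ℂ)) 0 1 := by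
      refine Real.circleAverage_congr_sphere fun ζ hζ => ?_
      have : ζ ≠ 0 := by rintro rfl; simp at hζ
      simp [herglotzRieszKernel_def, this]
    have h5 := Complex.imCLM.circleAverage_comp_comm hint'
    rw [h4, ← Complex.imCLM_apply, ← h5]
    simp [Function.comp_def, Real.circleAverage_const]
  have hkim : k.im = (G 0).im := by
    rw [← hk0, Pi.sub_apply, Complex.sub_im, hS0, sub_zero]
  have hkeq : k = (G 0).im * Complex.I := by
    apply Complex.ext <;> simp [hkre, hkim]
  rw [← hkeq, ← hk w hw]
  simp [S]

/-- **Herglotz representation theorem** for a normalized function on the unit disc. -/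
theorem DifferentiableOn.exists_herglotz_representation {G : ℂ → ℂ}
    (hG : DifferentiableOn ℂ G (ball 0 1)) (hpos : ∀ w ∈ ball (0 : ℂ) 1, 0 ≤ (G w).re)
    (h1 : (G 0).re = 1) :
    ∃ σ : ProbabilityMeasure (sphere (0 : ℂ) 1), ∀ w ∈ ball (0 : ℂ) 1,
      G w = (G 0).im * Complex.I
        + ∫ ζ : sphere (0 : ℂ) 1, herglotzRieszKernel 0 w ζ ∂(σ : Measure (sphere (0 : ℂ) 1)) := by
  -- Radii tending to 1; the shift by 2 keeps them positive from n = 0 on.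
  let r : ℕ → ℝ := fun n => 1 - 1 / ((n : ℝ) + 2)
  have hr0 (n : ℕ) : 0 < r n := by
    have : 1 / ((n : ℝ) + 2) < 1 := by
      rw [div_lt_one (by positivity)]; linarith [n.cast_nonneg (α := ℝ)]
    simp only [r]; linarith
  have hr1 (n : ℕ) : r n < 1 := by
    have : 0 < 1 / ((n : ℝ) + 2) := by positivity
    simp only [r]; linarith
  have hr : Tendsto r atTop (𝓝 1) := by
    have h : Tendsto (fun n : ℕ => 1 / ((n : ℝ) + 2)) atTop (𝓝 0) := by
      have := (tendsto_natCast_atTop_atTop (R := ℝ)).atTop_add (tendsto_const_nhds (x := (2 : ℝ)))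
      simp only [one_div]
      exact this.inv_tendsto_atTop
    simpa [r] using tendsto_const_nhds.sub h
  let Gr : ℕ → ℂ → ℂ := fun n w => G (r n * w)
  have hmaps (n : ℕ) : Set.MapsTo (fun w : ℂ => (r n : ℂ) * w) (ball 0 (r n)⁻¹) (ball 0 1) := by
    intro w hw
    rw [mem_ball_zero_iff] at hw ⊢
    rw [norm_mul, Complex.norm_real, Real.norm_of_nonneg (hr0 n).le]
    calc r n * ‖w‖ < r n * (r n)⁻¹ := mul_lt_mul_of_pos_left hw (hr0 n)
      _ = 1 := mul_inv_cancel₀ (hr0 n).ne'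
  have hGr (n : ℕ) : DifferentiableOn ℂ (Gr n) (ball 0 (r n)⁻¹) :=
    hG.comp (by fun_prop) (hmaps n)
  have hrinv (n : ℕ) : 1 < (r n)⁻¹ := (one_lt_inv₀ (hr0 n)).2 (hr1 n)
  have hGr0 (n : ℕ) : Gr n 0 = G 0 := by simp [Gr]
  have hschwarz (n : ℕ) {w : ℂ} (hw : w ∈ ball (0 : ℂ) 1) :=
    (hGr n).eq_circleAverage_herglotzRieszKernel (hrinv n) hw
  have hsph (n : ℕ) : sphere (0 : ℂ) 1 ⊆ ball 0 (r n)⁻¹ :=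
    sphere_subset_closedBall.trans (closedBall_subset_ball (hrinv n))
  have hdens (n : ℕ) := exists_probabilityMeasure_sphere_of_density
    (p := fun ζ => (Gr n ζ).re)
    (Complex.continuous_re.comp_continuousOn ((hGr n).continuousOn.mono (hsph n)))
    (fun ζ hζ => hpos _ (hmaps n (hsph n hζ)))
    (by
      have hdc : DiffContOnCl ℂ (Gr n) (ball 0 |(1 : ℝ)|) :=
        DifferentiableOn.diffContOnCl (by
          rw [abs_one, closure_ball _ one_ne_zero]
          exact (hGr n).mono (closedBall_subset_ball (hrinv n)))
      have hint : CircleIntegrable (Gr n) 0 1 :=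
        ((hGr n).continuousOn.mono (hsph n)).circleIntegrable zero_le_one
      have h2 := Complex.reCLM.circleAverage_comp_comm hint
      rw [hdc.circleAverage, hGr0, Complex.reCLM_apply, h1] at h2
      exact h2)
  choose σ hσ using hdens
  -- Probability measures on the compact circle form a compact space, so an ultrafilter limit exists
  -- without extracting a subsequence.
  let U : Ultrafilter ℕ := hyperfilter ℕ
  have hU : (U : Filter ℕ) ≤ atTop := Nat.hyperfilter_le_atTop
  have hlim : Tendsto σ U (𝓝 (U.map σ).lim) := (U.map σ).le_nhds_lim
  rw [ProbabilityMeasure.tendsto_iff_forall_integral_rclike_tendsto ℂ] at hlim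
  refine ⟨(U.map σ).lim, fun w hw => ?_⟩
  have hk : Continuous fun ζ : sphere (0 : ℂ) 1 => herglotzRieszKernel 0 w ζ := by
    have := continuousOn_herglotzRieszKernel_sphere hw
    rw [abs_one] at this
    exact this.comp_continuous continuous_subtype_val fun ζ => ζ.2
  have hlim1 := hlim (BoundedContinuousFunction.mkOfCompact ⟨_, hk⟩)
  have hlim2 : Tendsto (fun n => Gr n w) U (𝓝 (G w)) := by
    have hc : Tendsto (fun n => (r n : ℂ) * w) U (𝓝 w) := by
      have : Tendsto (fun n => (r n : ℂ) * w) atTop (𝓝 (((1 : ℝ) : ℂ) * w)) :=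
        ((Complex.continuous_ofReal.tendsto 1).comp hr).mul_const w
      rw [Complex.ofReal_one, one_mul] at this
      exact this.mono_left hU
    exact ((hG.continuousOn.continuousAt (isOpen_ball.mem_nhds hw)).tendsto).comp hc
  have heq (n : ℕ) : Gr n w = (G 0).im * Complex.I
      + ∫ ζ : sphere (0 : ℂ) 1, herglotzRieszKernel 0 w ζ ∂(σ n : Measure (sphere (0 : ℂ) 1)) := by
    rw [hσ n _ hk _ fun ζ => rfl, hschwarz n hw, hGr0]
  simp_rw [heq] at hlim2
  exact tendsto_nhds_unique hlim2 (tendsto_const_nhds.add hlim1)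

theorem Complex.ofReal_sub_ne_zero_of_im_ne_zero {z : ℂ} (hz : z.im ≠ 0) (t : ℝ) :
    (t : ℂ) - z ≠ 0 := by
  intro h
  have := congrArg Complex.im h
  simp at this
  exact hz this

theorem Complex.one_add_ofReal_sq_ne_zero (t : ℝ) : (1 : ℂ) + (t : ℂ) ^ 2 ≠ 0 := by
  have : (1 + t ^ 2 : ℝ) ≠ 0 := by positivity
  exact_mod_cast this

/-- The Cayley transform turns the Herglotz-Riesz kernel of the disc into the Nevanlinna kernel of
the half-plane. -/
theorem I_mul_herglotzRieszKernel_cayley {z ζ : ℂ} (hz : 0 < z.im) (hζ : ‖ζ‖ = 1) (hζ1 : ζ ≠ 1) :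
    Complex.I * herglotzRieszKernel 0 ((z - Complex.I) / (z + Complex.I)) ζ
      = (1 + ((-ζ.im / (1 - ζ.re) : ℝ) : ℂ) * z) / (((-ζ.im / (1 - ζ.re) : ℝ) : ℂ) - z) := by
  have hsq : ζ.re ^ 2 + ζ.im ^ 2 = 1 := by
    have := Complex.sq_norm ζ
    rw [hζ, Complex.normSq_apply] at this
    linarith
  have hre : 1 - ζ.re ≠ 0 := by
    intro h
    refine hζ1 (Complex.ext (by simp; linarith) ?_)
    have h1 : ζ.re = 1 := by linarith
    rw [h1] at hsq
    simpa using hsq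
  -- This is i(1 + ζ)/(1 - ζ), the real point that the Cayley transform sends to ζ.
  set t : ℝ := -ζ.im / (1 - ζ.re) with ht
  have htm : t * (1 - ζ.re) = -ζ.im := by rw [ht, div_mul_cancel₀ _ hre]
  have h1 : ζ * (t + Complex.I) = t - Complex.I := by
    apply Complex.ext
    · simp; linarith
    · have : t * ζ.im = -1 - ζ.re := by
        have h2 : t * ζ.im * (1 - ζ.re) = (-1 - ζ.re) * (1 - ζ.re) := by
          linear_combination ζ.im * htm - hsq
        exact mul_right_cancel₀ hre h2
      simp; linarith
  have hti : (t : ℂ) + Complex.I ≠ 0 := by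
    have := Complex.ofReal_sub_ne_zero_of_im_ne_zero (z := -Complex.I) (by simp) t
    simpa using this
  have hzi : z + Complex.I ≠ 0 := by
    intro h
    have := congrArg Complex.im h
    simp at this
    linarith
  have htz := Complex.ofReal_sub_ne_zero_of_im_ne_zero hz.ne' t
  have h3 : ζ = (t - Complex.I) / (t + Complex.I) := by rw [eq_div_iff hti, h1]
  have hden : ζ - (z - Complex.I) / (z + Complex.I)
      = 2 * Complex.I * (t - z) / ((t + Complex.I) * (z + Complex.I)) := by
    rw [h3]; field_simp; ring
  have hnum : ζ + (z - Complex.I) / (z + Complex.I)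
      = 2 * (1 + t * z) / ((t + Complex.I) * (z + Complex.I)) := by
    rw [h3]; field_simp; linear_combination -2 * Complex.I_sq
  rw [herglotzRieszKernel_def, sub_zero, sub_zero, hden, hnum]
  field_simp

/-- **Nevanlinna representation theorem**, for a Herglotz-Nevanlinna function with
`Im F(i) = 1`. -/
theorem DifferentiableOn.exists_nevanlinna_representation {F : ℂ → ℂ}
    (hF : DifferentiableOn ℂ F {z | 0 < z.im}) (hpos : ∀ z : ℂ, 0 < z.im → 0 ≤ (F z).im)
    (h1 : (F Complex.I).im = 1) :
    ∃ (b : ℝ) (ρ : Measure ℝ), 0 ≤ b ∧ IsFiniteMeasure ρ ∧ b + ρ.real Set.univ = 1 ∧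
      ∀ z : ℂ, 0 < z.im → F z = (F Complex.I).re + b * z + ∫ t : ℝ, (1 + t * z) / (t - z) ∂ρ := by
  let C : ℂ → ℂ := fun w => Complex.I * (1 + w) / (1 - w)
  have hne {w : ℂ} (hw : w ∈ ball (0 : ℂ) 1) : 1 - w ≠ 0 := by
    intro h
    rw [← sub_eq_zero.1 h] at hw
    simp at hw
  have hCim {w : ℂ} (hw : w ∈ ball (0 : ℂ) 1) : 0 < (C w).im := by
    have h2 : (C w).im = (1 - Complex.normSq w) / Complex.normSq (1 - w) := by
      simp only [C, Complex.div_im, Complex.normSq_apply]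
      simp
      ring
    rw [h2]
    refine div_pos ?_ (Complex.normSq_pos.2 (hne hw))
    rw [Complex.normSq_eq_norm_sq]
    rw [mem_ball_zero_iff] at hw
    nlinarith [norm_nonneg w]
  let G : ℂ → ℂ := fun w => -Complex.I * F (C w)
  have hC : DifferentiableOn ℂ C (ball 0 1) := by
    intro w hw
    have := hne hw
    exact DifferentiableAt.differentiableWithinAt (by fun_prop (disch := assumption))
  have hG : DifferentiableOn ℂ G (ball 0 1) :=
    (hF.comp hC fun w hw => hCim hw).const_mul _
  have hC0 : C 0 = Complex.I := by simp [C]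
  obtain ⟨σ, hσ⟩ := hG.exists_herglotz_representation
    (fun w hw => by
      have h2 : (G w).re = (F (C w)).im := by simp [G]
      rw [h2]; exact hpos _ (hCim hw))
    (by simp [G, hC0, h1])
  have hG0 : (G 0).im = -(F Complex.I).re := by simp [G, hC0]
  let S := sphere (0 : ℂ) 1
  let e : S := ⟨1, mem_sphere_zero_iff_norm.2 norm_one⟩
  let τ : S → ℝ := fun ζ => -(ζ : ℂ).im / (1 - (ζ : ℂ).re)
  have hτ : Measurable τ :=
    ((Complex.measurable_im.comp measurable_subtype_coe).neg).div
      (measurable_const.sub (Complex.measurable_re.comp measurable_subtype_coe))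
  let m : Measure S := σ
  -- The point ζ = 1 corresponds to t = ∞: its mass is the coefficient of the linear term, and the
  -- rest of the measure moves to the line.
  refine ⟨m.real {e}, (m.restrict {e}ᶜ).map τ, measureReal_nonneg, inferInstance, ?_, ?_⟩
  · rw [map_measureReal_apply hτ MeasurableSet.univ, Set.preimage_univ, measureReal_restrict_apply
      MeasurableSet.univ, Set.univ_inter, measureReal_add_measureReal_compl
      (measurableSet_singleton e)]
    exact probReal_univ
  · intro z hz
    have hzi : z + Complex.I ≠ 0 := by
      intro h
      have := congrArg Complex.im h
      simp at this
      linarith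
    set w : ℂ := (z - Complex.I) / (z + Complex.I) with hw_def
    have hw : w ∈ ball (0 : ℂ) 1 := by
      rw [mem_ball_zero_iff, hw_def, norm_div, div_lt_one (norm_pos_iff.2 hzi)]
      refine lt_of_pow_lt_pow_left₀ 2 (norm_nonneg _) ?_
      rw [Complex.sq_norm, Complex.sq_norm, Complex.normSq_apply, Complex.normSq_apply]
      simp
      nlinarith
    have hCw : C w = z := by
      have h2 := hne hw
      simp only [C]
      rw [div_eq_iff h2, hw_def]
      field_simp
      ring
    have hFz : F z = Complex.I * G w := by
      simp only [G, hCw]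
      linear_combination F z * Complex.I_sq
    have hk : Continuous fun ζ : S => herglotzRieszKernel 0 w ζ := by
      have := continuousOn_herglotzRieszKernel_sphere hw
      rw [abs_one] at this
      exact this.comp_continuous continuous_subtype_val fun ζ => ζ.2
    have hint : Integrable (fun ζ : S => herglotzRieszKernel 0 w ζ) m :=
      hk.integrable_of_hasCompactSupport (HasCompactSupport.of_compactSpace _)
    have hsplit := integral_add_compl (measurableSet_singleton e) hint
    rw [integral_singleton] at hsplit
    have hke : Complex.I * herglotzRieszKernel 0 w (e : ℂ) = z := by
      rw [herglotzRieszKernel_def, ← hCw]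
      simp only [C, e, sub_zero]
      ring
    have hmeas : Measurable fun t : ℝ => (1 + (t : ℂ) * z) / ((t : ℂ) - z) := by fun_prop
    have hmap : ∫ t : ℝ, (1 + t * z) / (t - z) ∂(m.restrict {e}ᶜ).map τ
        = Complex.I * ∫ ζ in {e}ᶜ, herglotzRieszKernel 0 w ζ ∂m := by
      rw [integral_map hτ.aemeasurable hmeas.aestronglyMeasurable, ← integral_const_mul]
      refine setIntegral_congr_fun (measurableSet_singleton e).compl fun ζ hζ => ?_
      exact (I_mul_herglotzRieszKernel_cayley hz (by simp)
        fun h => hζ (Subtype.ext h)).symm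
    rw [hmap, hFz, hσ w hw, ← hsplit, hG0, Complex.real_smul]
    push_cast
    linear_combination (-(F Complex.I).re : ℂ) * Complex.I_sq + (m.real {e} : ℂ) * hke

/-! ### Kernel integrals along the imaginary axis -/

/-- The integral kernel of the Nevanlinna representation. -/
noncomputable def nevanlinnaKernel (z : ℂ) (t : ℝ) : ℂ :=
  1 / ((t : ℂ) - z) - (t : ℂ) / (1 + (t : ℂ) ^ 2)

theorem measurable_nevanlinnaKernel (z : ℂ) : Measurable (nevanlinnaKernel z) := by
  unfold nevanlinnaKernel; fun_prop

/-- This matches the two normalizations of the representation: a finite measure ρ and the measure (1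
+ t²)dρ. -/
theorem one_add_sq_mul_nevanlinnaKernel {z : ℂ} (hz : z.im ≠ 0) (t : ℝ) :
    (1 + (t : ℂ) ^ 2) * nevanlinnaKernel z t = (1 + t * z) / (t - z) := by
  have h1 := Complex.ofReal_sub_ne_zero_of_im_ne_zero hz t
  have h2 := Complex.one_add_ofReal_sq_ne_zero t
  rw [nevanlinnaKernel]
  field_simp
  ring

theorem nevanlinnaKernel_im (y : ℝ) (t : ℝ) :
    (nevanlinnaKernel (y * Complex.I) t).im = y / (t ^ 2 + y ^ 2) := by
  have h : (t : ℂ) / (1 + (t : ℂ) ^ 2) = ((t / (1 + t ^ 2) : ℝ) : ℂ) := by push_cast; rfl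
  rw [nevanlinnaKernel, h, Complex.sub_im, Complex.ofReal_im, sub_zero, one_div, Complex.inv_im,
    Complex.normSq_apply]
  simp [← pow_two]

theorem nevanlinnaKernel_I (t : ℝ) :
    nevanlinnaKernel Complex.I t = ((1 / (1 + t ^ 2) : ℝ) : ℂ) * Complex.I := by
  have h1 := Complex.ofReal_sub_ne_zero_of_im_ne_zero (z := Complex.I) (by simp) t
  have h2 := Complex.one_add_ofReal_sq_ne_zero t
  rw [nevanlinnaKernel]
  push_cast
  field_simp
  linear_combination Complex.I_sq

theorem norm_one_add_mul_div_le {y : ℝ} (hy : 0 < y) (t : ℝ) :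
    ‖(1 + t * (y * Complex.I)) / ((t : ℂ) - y * Complex.I)‖ ≤ y + 1 / y := by
  have h1 := Complex.ofReal_sub_ne_zero_of_im_ne_zero (z := y * Complex.I) (by simpa using hy.ne') t
  rw [norm_div, div_le_iff₀ (norm_pos_iff.2 h1)]
  refine le_of_sq_le_sq ?_ (by positivity)
  rw [mul_pow, Complex.sq_norm, Complex.sq_norm, Complex.normSq_apply, Complex.normSq_apply]
  simp
  have h2 : (y + y⁻¹) ^ 2 * (t * t + y * y) = y ^ 2 * t ^ 2 + y ^ 4 + 2 * t ^ 2 + 2 * y ^ 2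
      + (t / y) ^ 2 + 1 := by
    field_simp
    ring
  rw [h2]
  nlinarith [sq_nonneg (t / y), sq_nonneg t, sq_nonneg y, sq_nonneg (y ^ 2)]

theorem norm_nevanlinnaKernel_le {y : ℝ} (hy : 0 < y) (t : ℝ) :
    ‖nevanlinnaKernel (y * Complex.I) t‖ ≤ (y + 1 / y) * (1 / (1 + t ^ 2)) := by
  have h := norm_one_add_mul_div_le hy t
  rw [← one_add_sq_mul_nevanlinnaKernel (by simpa using hy.ne'), norm_mul] at h
  have h3 : ‖(1 : ℂ) + (t : ℂ) ^ 2‖ = 1 + t ^ 2 := by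
    rw [show (1 : ℂ) + (t : ℂ) ^ 2 = ((1 + t ^ 2 : ℝ) : ℂ) by push_cast; rfl, Complex.norm_real,
      Real.norm_of_nonneg (by positivity)]
  rw [h3] at h
  rw [mul_one_div, le_div_iff₀ (by positivity)]
  linarith

section Measure

variable {μ : Measure ℝ}

theorem integrable_one_div_one_add_sq
    (hμ : ∫⁻ t : ℝ, ENNReal.ofReal (1 / (1 + t ^ 2)) ∂μ = 1) :
    Integrable (fun t : ℝ => 1 / (1 + t ^ 2)) μ := by
  refine ⟨Measurable.aestronglyMeasurable (by fun_prop), ?_⟩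
  rw [hasFiniteIntegral_iff_ofReal (Eventually.of_forall fun t => by positivity), hμ]
  exact ENNReal.one_lt_top

theorem integral_one_div_one_add_sq_eq_one
    (hμ : ∫⁻ t : ℝ, ENNReal.ofReal (1 / (1 + t ^ 2)) ∂μ = 1) :
    ∫ t : ℝ, 1 / (1 + t ^ 2) ∂μ = 1 := by
  rw [integral_eq_lintegral_of_nonneg_ae (Eventually.of_forall fun t => by positivity)
    (Measurable.aestronglyMeasurable (by fun_prop)), hμ, ENNReal.toReal_one]

theorem integrable_nevanlinnaKernel
    (hμ : ∫⁻ t : ℝ, ENNReal.ofReal (1 / (1 + t ^ 2)) ∂μ = 1) {y : ℝ} (hy : 0 < y) :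
    Integrable (nevanlinnaKernel (y * Complex.I)) μ :=
  ((integrable_one_div_one_add_sq hμ).const_mul (y + 1 / y)).mono'
    (measurable_nevanlinnaKernel _).aestronglyMeasurable
    (Eventually.of_forall (norm_nevanlinnaKernel_le hy))

theorem integral_nevanlinnaKernel_I
    (hμ : ∫⁻ t : ℝ, ENNReal.ofReal (1 / (1 + t ^ 2)) ∂μ = 1) :
    ∫ t, nevanlinnaKernel Complex.I t ∂μ = Complex.I := by
  simp_rw [nevanlinnaKernel_I]
  rw [integral_mul_const, integral_complex_ofReal, integral_one_div_one_add_sq_eq_one hμ]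
  simp

theorem integral_nevanlinnaKernel_im
    (hμ : ∫⁻ t : ℝ, ENNReal.ofReal (1 / (1 + t ^ 2)) ∂μ = 1) {y : ℝ} (hy : 0 < y) :
    (∫ t, nevanlinnaKernel (y * Complex.I) t ∂μ).im = ∫ t, y / (t ^ 2 + y ^ 2) ∂μ := by
  have h := Complex.imCLM.integral_comp_comm (integrable_nevanlinnaKernel hμ hy)
  rw [← Complex.imCLM_apply, ← h]
  simp [nevanlinnaKernel_im]

theorem integrable_div_sq_add_sq
    (hμ : ∫⁻ t : ℝ, ENNReal.ofReal (1 / (1 + t ^ 2)) ∂μ = 1) {y : ℝ} (hy : 0 < y) :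
    Integrable (fun t : ℝ => y / (t ^ 2 + y ^ 2)) μ := by
  have h := Complex.imCLM.integrable_comp (integrable_nevanlinnaKernel hμ hy)
  refine h.congr (Eventually.of_forall fun t => ?_)
  simp [nevanlinnaKernel_im]

/-- For an infinite measure, `y ∫ y / (t² + y²) dμ` is not eventually bounded. -/
theorem not_eventually_mul_integral_le (hinf : μ Set.univ = ∞)
    (hμ : ∫⁻ t : ℝ, ENNReal.ofReal (1 / (1 + t ^ 2)) ∂μ = 1) (C : ℝ) :
    ¬ ∀ᶠ y : ℝ in atTop, y * ∫ t, y / (t ^ 2 + y ^ 2) ∂μ ≤ C := by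
  intro hC
  have hlim : Tendsto (fun n : ℕ => (n : ℝ)) atTop atTop := tendsto_natCast_atTop_atTop
  have h1 : ∀ᶠ n : ℕ in atTop,
      ∫⁻ t : ℝ, ENNReal.ofReal ((n : ℝ) * (n / (t ^ 2 + (n : ℝ) ^ 2))) ∂μ ≤ ENNReal.ofReal C := by
    filter_upwards [hlim.eventually hC, eventually_gt_atTop 0] with n hn hn0
    have hn0' : (0 : ℝ) < n := by exact_mod_cast hn0
    rw [← ofReal_integral_eq_lintegral_ofReal ((integrable_div_sq_add_sq hμ hn0').const_mul _)
      (Eventually.of_forall fun t => by positivity), integral_const_mul]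
    exact ENNReal.ofReal_le_ofReal hn
  have h2 (t : ℝ) : Tendsto (fun n : ℕ => ENNReal.ofReal ((n : ℝ) * (n / (t ^ 2 + (n : ℝ) ^ 2))))
      atTop (𝓝 1) := by
    have h3 : Tendsto (fun n : ℕ => t ^ 2 / (t ^ 2 + (n : ℝ) ^ 2)) atTop (𝓝 0) :=
      tendsto_const_nhds.div_atTop (tendsto_const_nhds.add_atTop
        ((tendsto_pow_atTop two_ne_zero).comp hlim))
    have h4 : Tendsto (fun n : ℕ => (n : ℝ) * (n / (t ^ 2 + (n : ℝ) ^ 2))) atTop (𝓝 1) := by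
      have h5 := tendsto_const_nhds (x := (1 : ℝ)) |>.sub h3
      rw [sub_zero] at h5
      refine h5.congr' ?_
      filter_upwards [eventually_gt_atTop 0] with n hn0
      have hn0' : (0 : ℝ) < n := by exact_mod_cast hn0
      field_simp
      ring
    simpa using ENNReal.tendsto_ofReal h4
  -- The integrands n²/(t² + n²) tend to 1, so by Fatou a bound C would bound the total mass.
  have h6 := lintegral_liminf_le (μ := μ) (u := atTop)
    (f := fun (n : ℕ) (t : ℝ) => ENNReal.ofReal ((n : ℝ) * (n / (t ^ 2 + (n : ℝ) ^ 2))))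
    (fun n => by fun_prop)
  simp_rw [fun t => (h2 t).liminf_eq] at h6
  rw [lintegral_one, hinf, top_le_iff] at h6
  have h7 : liminf (fun n : ℕ => ∫⁻ t : ℝ,
      ENNReal.ofReal ((n : ℝ) * (n / (t ^ 2 + (n : ℝ) ^ 2))) ∂μ) atTop ≤ ENNReal.ofReal C :=
    liminf_le_of_frequently_le' h1.frequently
  rw [h6, top_le_iff] at h7
  exact ENNReal.ofReal_ne_top h7

/-- After division by y the integrand is 1/(t² + y²), dominated by 1/(1 + t²) for y ≥ 1. For V this
says Im V(iy) = o(y). -/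
theorem tendsto_integral_div_atTop
    (hμ : ∫⁻ t : ℝ, ENNReal.ofReal (1 / (1 + t ^ 2)) ∂μ = 1) :
    Tendsto (fun y : ℝ => (∫ t, y / (t ^ 2 + y ^ 2) ∂μ) / y) atTop (𝓝 0) := by
  have h1 : Tendsto (fun y : ℝ => ∫ t, 1 / (t ^ 2 + y ^ 2) ∂μ) atTop (𝓝 (∫ _, (0 : ℝ) ∂μ)) := by
    refine tendsto_integral_filter_of_dominated_convergence (fun t => 1 / (1 + t ^ 2))
      (Eventually.of_forall fun y => Measurable.aestronglyMeasurable (by fun_prop)) ?_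
      (integrable_one_div_one_add_sq hμ) (Eventually.of_forall fun t => ?_)
    · filter_upwards [eventually_ge_atTop 1] with y hy
      refine Eventually.of_forall fun t => ?_
      rw [Real.norm_of_nonneg (by positivity)]
      exact one_div_le_one_div_of_le (by positivity) (by nlinarith)
    · exact tendsto_const_nhds.div_atTop
        (tendsto_const_nhds.add_atTop (tendsto_pow_atTop two_ne_zero))
  rw [integral_zero] at h1
  refine h1.congr' ?_
  filter_upwards [eventually_gt_atTop 0] with y hy
  rw [← integral_div]
  refine integral_congr_ae (Eventually.of_forall fun t => ?_)
  simp only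
  field_simp

end Measure

/-! ### Möbius transforms of perturbed Donoghue functions -/

/-- The imaginary part of a Moebius transform with real coefficients of determinant one. -/
theorem Complex.im_mul_normSq_of_moebius {c s : ℝ} (hcs : c ^ 2 + s ^ 2 = 1) {V F : ℂ}
    (h : F * (s - c * V) = c + s * V) : F.im * Complex.normSq (s - c * V) = V.im := by
  have hre := congrArg Complex.re h
  have him := congrArg Complex.im h
  simp at hre him
  rw [Complex.normSq_apply]
  simp
  linear_combination (s - c * V.re) * him + c * V.im * hre + V.im * hcs

/-- Numerator and denominator of a Möbius map of nonzero determinant cannot vanish together. -/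
theorem Complex.sub_mul_ne_zero_of_moebius {c s : ℝ} (hcs : c ^ 2 + s ^ 2 = 1) {V F : ℂ}
    (h : F * (s - c * V) = c + s * V) : (s : ℂ) - c * V ≠ 0 := by
  intro h0
  rw [h0, mul_zero] at h
  have hcs' : (c : ℂ) ^ 2 + (s : ℂ) ^ 2 = 1 := by exact_mod_cast hcs
  have : (1 : ℂ) = 0 := by linear_combination -hcs' - c * h + s * h0
  exact one_ne_zero this

namespace LSys

/-- At i the kernel is i/(1 + t²), so the normalization of μ fixes the integral. -/
theorem IsPerturbedDonoghue.apply_I {Q : ℝ} {V : ℂ → ℂ} (hV : IsPerturbedDonoghue Q V) :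
    V Complex.I = Q + Complex.I := by
  obtain ⟨-, -, μ, -, hμ, h⟩ := hV
  rw [h _ (by simp)]
  congr 1
  exact integral_nevanlinnaKernel_I hμ

/-- A Moebius transform `F = (c + s V) / (s - c V)`, with `c ≠ 0`, of a function of a perturbed
Donoghue class belongs to such a class as soon as `Im F(i) = 1`. -/
theorem IsPerturbedDonoghue.of_moebius {Q Q' c s : ℝ} {V F : ℂ → ℂ}
    (hV : IsPerturbedDonoghue Q V) (hc : c ≠ 0) (hcs : c ^ 2 + s ^ 2 = 1)
    (hF : ∀ z : ℂ, 0 < z.im → F z * (s - c * V z) = c + s * V z)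
    (hFI : F Complex.I = Q' + Complex.I) : IsPerturbedDonoghue Q' F := by
  obtain ⟨hVd, hVpos, μ, hinf, hμ, hVint⟩ := hV
  have hne (z : ℂ) (hz : 0 < z.im) : (s : ℂ) - c * V z ≠ 0 :=
    Complex.sub_mul_ne_zero_of_moebius hcs (hF z hz)
  have hFim (z : ℂ) (hz : 0 < z.im) := Complex.im_mul_normSq_of_moebius hcs (hF z hz)
  have hFd : DifferentiableOn ℂ F {z | 0 < z.im} :=
    (((hVd.const_mul (s : ℂ)).const_add (c : ℂ)).div
      ((hVd.const_mul (c : ℂ)).const_sub (s : ℂ)) hne).congr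
      fun z hz => eq_div_of_mul_eq (hne z hz) (hF z hz)
  have hFpos (z : ℂ) (hz : 0 < z.im) : 0 ≤ (F z).im := by
    have h1 := hVpos z hz
    rw [← hFim z hz] at h1
    exact nonneg_of_mul_nonneg_left h1 (Complex.normSq_pos.2 (hne z hz))
  have hVim {y : ℝ} (hy : 0 < y) : (V (y * Complex.I)).im = ∫ t, y / (t ^ 2 + y ^ 2) ∂μ := by
    rw [hVint _ (by simpa using hy), Complex.add_im, Complex.ofReal_im, zero_add]
    exact integral_nevanlinnaKernel_im hμ hy
  have hunb (C : ℝ) : ¬ ∀ᶠ y : ℝ in atTop, y * (V (y * Complex.I)).im ≤ C := by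
    intro h
    refine not_eventually_mul_integral_le hinf hμ C ?_
    filter_upwards [h, eventually_gt_atTop 0] with y h1 h2
    rwa [← hVim h2]
  obtain ⟨b, ρ, hb0, hρ, hbρ, hrep⟩ :=
    hFd.exists_nevanlinna_representation hFpos (by simp [hFI])
  -- a lower bound for the imaginary part on the imaginary axis
  have hFlow {y : ℝ} (hy : 1 ≤ y) : b * y + ρ.real Set.univ / y ≤ (F (y * Complex.I)).im := by
    have hy0 : 0 < y := by linarith
    have hyI : (y * Complex.I).im ≠ 0 := by simpa using hy0.ne'
    have hint : Integrable
        (fun t : ℝ => (1 + t * (y * Complex.I)) / ((t : ℂ) - y * Complex.I)) ρ :=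
      Integrable.of_bound (Measurable.aestronglyMeasurable (by fun_prop)) _
        (Eventually.of_forall (norm_one_add_mul_div_le hy0))
    have hintim := Complex.imCLM.integral_comp_comm hint
    have him (t : ℝ) : ((1 + t * (y * Complex.I)) / ((t : ℂ) - y * Complex.I)).im
        = (1 + t ^ 2) * (y / (t ^ 2 + y ^ 2)) := by
      rw [← one_add_sq_mul_nevanlinnaKernel hyI, ← nevanlinnaKernel_im,
        show (1 : ℂ) + (t : ℂ) ^ 2 = ((1 + t ^ 2 : ℝ) : ℂ) by push_cast; rfl, Complex.im_ofReal_mul]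
    have hle : ρ.real Set.univ / y
        ≤ ∫ t : ℝ, ((1 + t * (y * Complex.I)) / ((t : ℂ) - y * Complex.I)).im ∂ρ := by
      have h1 : ρ.real Set.univ / y = ∫ _ : ℝ, 1 / y ∂ρ := by
        rw [integral_const, smul_eq_mul, mul_one_div]
      rw [h1]
      -- Pointwise the claim is t² + y² ≤ y²(1 + t²), which is where y ≥ 1 is needed.
      refine integral_mono (integrable_const _) (Complex.imCLM.integrable_comp hint) fun t => ?_
      simp only [him]
      rw [mul_div_assoc', div_le_div_iff₀ hy0 (by positivity)]
      nlinarith [mul_nonneg (sq_nonneg t) (show 0 ≤ y ^ 2 - 1 by nlinarith)]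
    rw [hrep _ (by simpa using hy0), Complex.add_im, Complex.add_im, ← Complex.imCLM_apply
      (∫ t : ℝ, _ ∂ρ), ← hintim, Complex.ofReal_im, Complex.im_ofReal_mul]
    simpa using hle
  -- If b > 0, then Im V = Im F · |s - cV|² ≥ by · c²(Im V)² on the axis, so y Im V(iy) ≤ 1/(bc²),
  -- contradicting `hunb`.
  have hb : b = 0 := by
    by_contra hbne
    have hbpos : 0 < b := lt_of_le_of_ne hb0 (Ne.symm hbne)
    refine hunb (1 / (b * c ^ 2)) ?_
    filter_upwards [eventually_ge_atTop 1] with y hy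
    have hy0 : 0 < y := by linarith
    have hyI : 0 < (y * Complex.I).im := by simpa using hy0
    have h1 := hFim _ hyI
    have h2 := hFlow hy
    have h3 : 0 ≤ ρ.real Set.univ / y := div_nonneg measureReal_nonneg hy0.le
    have h4 := hVpos _ hyI
    set v := (V (y * Complex.I)).im with hv
    have h5 : c ^ 2 * v ^ 2 ≤ Complex.normSq (s - c * V (y * Complex.I)) := by
      rw [Complex.normSq_apply]
      simp only [Complex.sub_re, Complex.sub_im, Complex.ofReal_re, Complex.ofReal_im,
        Complex.re_ofReal_mul, Complex.im_ofReal_mul, ← hv]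
      nlinarith [sq_nonneg (s - c * (V (y * Complex.I)).re)]
    have h6 : (b * y) * (c ^ 2 * v ^ 2) ≤ v := by
      calc (b * y) * (c ^ 2 * v ^ 2)
          ≤ (F (y * Complex.I)).im * Complex.normSq (s - c * V (y * Complex.I)) :=
            mul_le_mul (by linarith) h5 (by positivity) (hFpos _ hyI)
        _ = v := h1
    rw [le_div_iff₀ (by positivity)]
    rcases h4.eq_or_lt with h7 | h7
    · rw [← h7]; simp
    · refine le_of_mul_le_mul_left ?_ h7
      linarith
  rw [hb, zero_add] at hbρ
  have hFre : (F Complex.I).re = Q' := by simp [hFI]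
  simp only [hb, Complex.ofReal_zero, zero_mul, add_zero, hFre] at hrep
  simp only [hb, zero_mul, zero_add, hbρ] at hFlow
  let d : ℝ → ℝ≥0∞ := fun t => ENNReal.ofReal (1 + t ^ 2)
  have hd : Measurable d := by fun_prop
  let ν : Measure ℝ := ρ.withDensity d
  have hFν (z : ℂ) (hz : 0 < z.im) : F z = Q' + ∫ t, nevanlinnaKernel z t ∂ν := by
    rw [hrep z hz, integral_withDensity_eq_integral_toReal_smul hd
      (Eventually.of_forall fun _ => ENNReal.ofReal_lt_top)]
    congr 1
    refine integral_congr_ae (Eventually.of_forall fun t => ?_)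
    simp only
    rw [← one_add_sq_mul_nevanlinnaKernel hz.ne', ENNReal.toReal_ofReal (by positivity),
      Complex.real_smul]
    push_cast
    rfl
  have hν : ∫⁻ t : ℝ, ENNReal.ofReal (1 / (1 + t ^ 2)) ∂ν = 1 := by
    rw [lintegral_withDensity_eq_lintegral_mul _ hd (by fun_prop)]
    have h1 (t : ℝ) : (d * fun t : ℝ => ENNReal.ofReal (1 / (1 + t ^ 2))) t = 1 := by
      simp only [Pi.mul_apply, d]
      rw [← ENNReal.ofReal_mul (by positivity), mul_one_div_cancel (by positivity),
        ENNReal.ofReal_one]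
    simp_rw [h1]
    rw [lintegral_one]
    rw [measureReal_def] at hbρ
    exact (ENNReal.toReal_eq_one_iff _).1 hbρ
  refine ⟨hFd, hFpos, ν, ?_, hν, hFν⟩
  -- With ν finite, F(iy) tends to a real q at rate 1/y. Inverting, V = (sF - c)/(s + cF), and the
  -- two cases are whether q is a pole of this map.
  by_contra hfin
  have hfinite : IsFiniteMeasure ν := ⟨lt_top_iff_ne_top.2 hfin⟩
  set M := ν.real Set.univ
  -- on the imaginary axis, `F` is `q + O(1 / y)`
  set q : ℝ := Q' - ∫ t : ℝ, t / (1 + t ^ 2) ∂ν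
  have hasymp {y : ℝ} (hy : 0 < y) : ‖F (y * Complex.I) - q‖ ≤ M / y := by
    have hyI : (y * Complex.I).im ≠ 0 := by simpa using hy.ne'
    have hbd (t : ℝ) : ‖1 / ((t : ℂ) - y * Complex.I)‖ ≤ 1 / y := by
      rw [norm_div, norm_one]
      refine one_div_le_one_div_of_le hy ?_
      have := Complex.abs_im_le_norm ((t : ℂ) - y * Complex.I)
      simpa [abs_of_pos hy] using this
    have hint1 : Integrable (fun t : ℝ => 1 / ((t : ℂ) - y * Complex.I)) ν :=
      Integrable.of_bound (Measurable.aestronglyMeasurable (by fun_prop)) _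
        (Eventually.of_forall hbd)
    have hint2 : Integrable (fun t : ℝ => t / (1 + t ^ 2)) ν := by
      refine Integrable.of_bound (Measurable.aestronglyMeasurable (by fun_prop)) 1
        (Eventually.of_forall fun t => ?_)
      rw [Real.norm_eq_abs, abs_div, abs_of_pos (by positivity : 0 < 1 + t ^ 2),
        div_le_one (by positivity)]
      nlinarith [sq_abs t, sq_nonneg (|t| - 1)]
    have hint2' : Integrable (fun t : ℝ => (t : ℂ) / (1 + (t : ℂ) ^ 2)) ν := by
      have := hint2.ofReal (𝕜 := ℂ)
      simpa using this
    have h2 : ∫ t : ℝ, (t : ℂ) / (1 + (t : ℂ) ^ 2) ∂ν = ((∫ t : ℝ, t / (1 + t ^ 2) ∂ν : ℝ) : ℂ) := by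
      rw [← integral_complex_ofReal]
      simp
    have h3 : F (y * Complex.I) - q = ∫ t : ℝ, 1 / ((t : ℂ) - y * Complex.I) ∂ν := by
      rw [hFν _ (by simpa using hy)]
      simp only [nevanlinnaKernel, q]
      rw [integral_sub hint1 hint2', h2]
      push_cast
      ring
    rw [h3]
    have h4 := norm_integral_le_of_norm_le_const (μ := ν) (Eventually.of_forall hbd)
    rwa [one_div_mul_eq_div] at h4
  have hM : 0 ≤ M := measureReal_nonneg
  -- The inverse map has the same form with -c in place of c.
  have hinv (z : ℂ) (hz : 0 < z.im) : (V z).im * Complex.normSq (s + c * F z) = (F z).im := by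
    have h1 := Complex.im_mul_normSq_of_moebius (c := -c) (s := s) (V := F z) (F := V z)
      (by rw [neg_sq]; exact hcs)
      (by push_cast; linear_combination -hF z hz)
    simpa using h1
  have hnorm {y : ℝ} (hy : 0 < y) :
      ‖((s : ℂ) + c * F (y * Complex.I)) - ((s + c * q : ℝ) : ℂ)‖ ≤ |c| * (M / y) := by
    have h1 : ((s : ℂ) + c * F (y * Complex.I)) - ((s + c * q : ℝ) : ℂ)
        = c * (F (y * Complex.I) - q) := by push_cast; ring
    rw [h1, norm_mul, Complex.norm_real, Real.norm_eq_abs]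
    exact mul_le_mul_of_nonneg_left (hasymp hy) (abs_nonneg c)
  have hsmall : Tendsto (fun y : ℝ => |c| * (M / y)) atTop (𝓝 0) := by
    simpa using (tendsto_const_nhds (x := M)).div_atTop tendsto_id |>.const_mul |c|
  by_cases hq : s + c * q = 0
  · -- `V` grows linearly along the imaginary axis
    have hsmallV : Tendsto (fun y : ℝ => (V (y * Complex.I)).im / y) atTop (𝓝 0) := by
      refine (tendsto_integral_div_atTop hμ).congr' ?_
      filter_upwards [eventually_gt_atTop 0] with y hy
      rw [hVim hy]
    have hK : Tendsto (fun y : ℝ => (|c| * M) ^ 2 * ((V (y * Complex.I)).im / y)) atTop (𝓝 0) := by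
      simpa using hsmallV.const_mul ((|c| * M) ^ 2)
    -- Since 1/y ≤ Im F(iy) = Im V · |s + cF|² ≤ Im V · (|c|M/y)², a y with (|c|M)² Im V(iy)/y < 1
    -- is contradictory.
    obtain ⟨y, hlt, hy⟩ := ((hK.eventually (gt_mem_nhds one_pos)).and (eventually_ge_atTop 1)).exists
    have hy0 : 0 < y := by linarith
    have hyI : 0 < (y * Complex.I).im := by simpa using hy0
    have h1 := hnorm hy0
    rw [hq, Complex.ofReal_zero, sub_zero] at h1
    have h2 : Complex.normSq (s + c * F (y * Complex.I)) ≤ (|c| * (M / y)) ^ 2 := by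
      rw [Complex.normSq_eq_norm_sq]
      exact pow_le_pow_left₀ (norm_nonneg _) h1 2
    have h3 := mul_le_mul_of_nonneg_left h2 (hVpos _ hyI)
    rw [hinv _ hyI] at h3
    have h4 := (hFlow hy).trans h3
    have h5 : (V (y * Complex.I)).im * (|c| * (M / y)) ^ 2
        = (|c| * M) ^ 2 * ((V (y * Complex.I)).im / y) / y := by
      field_simp
    rw [h5, div_le_div_iff_of_pos_right hy0] at h4
    linarith
  · -- `y Im V(iy)` is bounded
    -- Half the limiting modulus: once |c|M/y < δ, the denominator s + cF(iy) has modulus at least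
    -- δ.
    set δ : ℝ := |s + c * q| / 2 with hδ
    have hδpos : 0 < δ := half_pos (abs_pos.2 hq)
    refine hunb (M / δ ^ 2) ?_
    filter_upwards [hsmall.eventually (gt_mem_nhds hδpos), eventually_ge_atTop 1] with y hlt hy
    have hy0 : 0 < y := by linarith
    have hyI : 0 < (y * Complex.I).im := by simpa using hy0
    have h1 := hnorm hy0
    have h2 : δ ≤ ‖(s : ℂ) + c * F (y * Complex.I)‖ := by
      have h3 := norm_sub_norm_le ((s + c * q : ℝ) : ℂ) ((s : ℂ) + c * F (y * Complex.I))
      rw [norm_sub_rev, Complex.norm_real, Real.norm_eq_abs] at h3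
      linarith
    have h4 : δ ^ 2 ≤ Complex.normSq (s + c * F (y * Complex.I)) := by
      rw [Complex.normSq_eq_norm_sq]
      exact pow_le_pow_left₀ hδpos.le h2 2
    have h5 := mul_le_mul_of_nonneg_left h4 (hVpos _ hyI)
    rw [hinv _ hyI] at h5
    have h6 : (F (y * Complex.I)).im ≤ M / y := by
      have h7 := (Complex.im_le_norm _).trans (hasymp hy0)
      simpa using h7
    rw [le_div_iff₀ (by positivity), mul_assoc]
    calc y * ((V (y * Complex.I)).im * δ ^ 2) ≤ y * (M / y) :=
          mul_le_mul_of_nonneg_left (h5.trans h6) hy0.le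
      _ = M := mul_div_cancel₀ _ hy0.ne'

end LSys

end Herglotz

theorem theorem5p3
    {H : Type*} [NormedAddCommGroup H] [InnerProductSpace ℂ H] [CompleteSpace H]
    {H' : Type*} [NormedAddCommGroup H'] [InnerProductSpace ℂ H'] [CompleteSpace H']
    (Θ : LSys.LSystem H ℂ) (hJ : Θ.J = ContinuousLinearMap.id ℂ ℂ)
    (Θα : LSys.LSystem H' ℂ) (hJα : Θα.J = ContinuousLinearMap.id ℂ ℂ)
    (Q : ℝ) (hQ : Q ≠ 0)
    (hV : LSys.IsPerturbedDonoghue Q Θ.scalarImpedance)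
    (α : ℝ) (hα : α ≠ Real.pi / 2)
    (hU : LSys.IsUnimodularTransformation Θ Θα α) :
    LSys.IsPerturbedDonoghue (-Q) Θα.scalarImpedance ↔ Real.tan α = Q / 2 := by
  have hc : Real.cos α ≠ 0 := by
    intro h
    obtain ⟨k, hk⟩ := Real.cos_eq_zero_iff.1 h
    obtain ⟨h0, h1⟩ := hU.1
    have hpi := Real.pi_pos
    have hk0 : (-1 : ℝ) < k := by nlinarith
    have hk1 : (k : ℝ) < 1 := by nlinarith
    have hk' : k = 0 := by
      have : -1 < k := by exact_mod_cast hk0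
      have : k < 1 := by exact_mod_cast hk1
      omega
    exact hα (by rw [hk, hk']; simp)
  have hcs : Real.cos α ^ 2 + Real.sin α ^ 2 = 1 := Real.cos_sq_add_sin_sq α
  have hF (z : ℂ) (hz : 0 < z.im) := hU.impedance_eq hJ hJα hz
  have hI := hF Complex.I (by simp)
  rw [hV.apply_I] at hI
  rw [Real.tan_eq_sin_div_cos, div_eq_div_iff hc two_ne_zero]
  constructor
  · intro h
    have him := Complex.im_mul_normSq_of_moebius hcs hI
    rw [h.apply_I, Complex.normSq_apply] at him
    simp [-Complex.ofReal_cos, -Complex.ofReal_sin] at him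
    -- The imaginary parts at i give (s - cQ)² + c² = 1; subtracting c² + s² = 1 leaves this
    -- factorization.
    have h2 : Real.cos α * Q * (Real.sin α * 2 - Q * Real.cos α) = 0 := by
      linear_combination hcs - him
    exact sub_eq_zero.1 ((mul_eq_zero.1 h2).resolve_left (mul_ne_zero hc hQ))
  · intro h
    refine hV.of_moebius hc hcs hF ?_
    -- Only the value at i is left: (-Q + i)(s - c(Q + i)) and c + s(Q + i) differ by Q(Qc - 2s).
    refine mul_right_cancel₀ (Complex.sub_mul_ne_zero_of_moebius hcs hI) (hI.trans ?_)
    have h' : (Real.sin α : ℂ) * 2 = Q * Real.cos α := by exact_mod_cast h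
    push_cast [-Complex.ofReal_cos, -Complex.ofReal_sin]
    linear_combination Q * h' + Real.cos α * Complex.I_sq
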